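/- Let $d\ge 1$ and let $\mathcal A$ be a $d$-dimensional commutative associative unital real algebra with nilradical $\mathcal N$ (the set of nilpotent elements) that is irreducible, i.e. $\mathcal A=\mathbb R\cdot 1_{\mathcal A}\oplus\mathcal N$. Let $a_2,\dots,a_d$ be a Jordan–Hölder basis of $\mathcal N$; that is, a basis of $\mathcal N$ such that, with $a_1=1_{\mathcal A}$ and $\mathcal I_k=\mathrm{span}(a_k,\dots,a_d)$, one has $\mathcal N\,\mathcal I_k\subset\mathcal I_{k+1}$ for $1\le k<d$. Then $a_1,\dots,a_d$ is a basis of $\mathcal A$, so $\psi(x)=\sum_i x_ia_i$ is a linear isomorphism $\mathbb R^d\to\mathcal A$; let $\Psi:\mathcal A\to\mathbb R^{d\times d}$ be the unique linear map with $\psi^{-1}(\tilde a\,\psi(x))=\Psi(\tilde a)x$ for all $\tilde a\in\mathcal A$, $x\in\mathbb R^d$. The following hold. (a) $S=\{I_d+\Psi(a)^T: a\in\mathcal N\}$ is a shearing subgroup of $\mathrm{GL}(d,\mathbb R)$, and its Lie algebra $\{X:\exp(\mathbb RX)\subset S\}$ is $\mathfrak s=\{\Psi(a)^T:a\in\mathcal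 N\}$. (b) Put $X_i=\Psi(a_i)^T$ for $1\le i\le d$. Then $X_1=I_d$, and $X_2,\dots,X_d$ is the canonical basis of $\mathfrak s$, i.e. the unique basis of $\mathfrak s$ with $X_i^Te_1=e_i$ for $2\le i\le d$. (c) Let $(d_{i,j,k})_{1\le i,j,k\le d}$ be the structure constants, the unique reals with $a_ia_j=\sum_{k=1}^d d_{i,j,k}a_k$ for all $i,j$. Then the entry of $X_i$ in row $j$ and column $k$ is $d_{i,j,k}$, for all $1\le i,j,k\le d$. (d) For all $1\le i,j,k\le d$: $d_{i,j,k}=d_{j,i,k}$ and $d_{1,j,k}=\delta_{j,k}$; and $d_{i,j,k}=0$ whenever $i,j\ge 2$ and $k\le\max(i,j)$. In particular, for $2\le i\le d$, $$X_i=E_{1,i}+\sum_{j=2}^d\sum_{k=j+1}^d d_{i,j,k}E_{j,k},$$ where $E_{j,k}$ is the matrix with entry $1$ in row $j$, column $k$ and zeros elsewhere. Here a subgroup $S<\mathrm{GL}(d,\mathbb R)$ is called a shearing subgroup if there are a closed group $H<\mathrm{GL}(d,\mathbb R)$ and a subgroup $D<H$ such that: (i) the quasi-regular representation $[\pi(x,h)f](y)=|\det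 h|^{-1/2}f(h^{-1}(y-x))$ of $\mathbb R^d\rtimes H$ on $L^2(\mathbb R^d)$ is irreducible (the only closed invariant subspaces are the trivial ones) and square-integrable (there is $\psi\ne0$ with $(x,h)\mapsto\langle\psi,\pi(x,h)\psi\rangle$ in $L^2$ of the left Haar measure $|\det h|^{-1}dx\,dh$); (ii) $S$ and $D$ are closed subgroups of $H$; (iii) $S$ is connected, abelian, and consists of upper triangular matrices with ones on the diagonal; (iv) $D=\{\exp(rY):r\in\mathbb R\}$ for a diagonal matrix $Y$; (v) every $h\in H$ can be written uniquely as $h=\pm\delta s$ with $\delta\in D$, $s\in S$. -/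

import Mathlib

open MeasureTheory
open scoped Matrix InnerProductSpace

namespace Shearlet

/-! ### The quasi-regular representation and irreducibly admissible dilation groups -/

/-- The Hilbert space `L²(ℝ^d)` of complex-valued functions. -/
abbrev L2 (d : ℕ) : Type := Lp ℂ 2 (volume : Measure (EuclideanSpace ℝ (Fin d)))

/-- The function `y ↦ |det h|^{-1/2} f (h⁻¹ (y - x))`. -/
noncomputable def dilateFun {d : ℕ} (x : EuclideanSpace ℝ (Fin d)) (h : GL (Fin d) ℝ)
    (f : EuclideanSpace ℝ (Fin d) → ℂ) (y : EuclideanSpace ℝ (Fin d)) : ℂ :=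
  ((|(h : Matrix (Fin d) (Fin d) ℝ).det| ^ (-(1 / 2) : ℝ) : ℝ) : ℂ) *
    f (Matrix.toEuclideanLin ((h⁻¹ : GL (Fin d) ℝ) : Matrix (Fin d) (Fin d) ℝ) (y - x))

theorem dilateFun_memLp {d : ℕ} (x : EuclideanSpace ℝ (Fin d)) (h : GL (Fin d) ℝ)
    {f : EuclideanSpace ℝ (Fin d) → ℂ} (hf : MemLp f 2 volume) :
    MemLp (dilateFun x h f) 2 volume := by
  have hdet : LinearMap.det (Matrix.toEuclideanLin
      ((h⁻¹ : GL (Fin d) ℝ) : Matrix (Fin d) (Fin d) ℝ)) ≠ 0 := by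
    have hu : IsUnit ((h⁻¹ : GL (Fin d) ℝ) : Matrix (Fin d) (Fin d) ℝ).det :=
      (Matrix.isUnit_iff_isUnit_det _).1 (h⁻¹ : GL (Fin d) ℝ).isUnit
    rw [← LinearMap.det_toMatrix (EuclideanSpace.basisFun (Fin d) ℝ).toBasis]
    convert hu.ne_zero using 2
    ext i j
    simp [LinearMap.toMatrix_apply]
  have hmeas : Measurable (Matrix.toEuclideanLin
      ((h⁻¹ : GL (Fin d) ℝ) : Matrix (Fin d) (Fin d) ℝ)) :=
    (LinearMap.continuous_of_finiteDimensional _).measurable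
  have h1 : MemLp (f ∘ Matrix.toEuclideanLin
      ((h⁻¹ : GL (Fin d) ℝ) : Matrix (Fin d) (Fin d) ℝ)) 2 volume := by
    have h2 : MemLp f 2 (Measure.map (Matrix.toEuclideanLin
        ((h⁻¹ : GL (Fin d) ℝ) : Matrix (Fin d) (Fin d) ℝ)) volume) := by
      rw [Measure.map_linearMap_addHaar_eq_smul_addHaar volume hdet]
      exact hf.smul_measure ENNReal.ofReal_ne_top
    exact (memLp_map_measure_iff h2.1 hmeas.aemeasurable).1 h2
  exact (h1.comp_measurePreserving (measurePreserving_sub_right volume x)).const_mul _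

/-- The quasi-regular representation
`[π(x,h) f](y) = |det h|^{-1/2} f (h⁻¹ (y - x))` on `L²(ℝ^d)`. -/
noncomputable def quasiRegular {d : ℕ} (x : EuclideanSpace ℝ (Fin d)) (h : GL (Fin d) ℝ)
    (f : L2 d) : L2 d :=
  (dilateFun_memLp x h (Lp.memLp f)).toLp _

/-- The restriction of the quasi-regular representation to the affine group `ℝ^d ⋊ H` is
irreducible: its only invariant closed subspaces are the trivial ones. -/
def QuasiRegularIrreducible {d : ℕ} (H : Subgroup (GL (Fin d) ℝ)) : Prop :=
  ∀ K : Submodule ℂ (L2 d), IsClosed (K : Set (L2 d)) →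
    (∀ (x : EuclideanSpace ℝ (Fin d)), ∀ h ∈ H, ∀ f ∈ K, quasiRegular x h f ∈ K) →
    K = ⊥ ∨ K = ⊤

/-- Square-integrability of the quasi-regular representation of `ℝ^d ⋊ H`: some nonzero `ψ` has
its matrix coefficient `(x,h) ↦ ⟨ψ, π(x,h) ψ⟩` in `L²` of the left Haar measure
`|det h|⁻¹ dx dh` of `ℝ^d ⋊ H`, where `dh` is a left Haar measure of `H`. -/
def QuasiRegularSquareIntegrable {d : ℕ} (H : Subgroup (GL (Fin d) ℝ)) : Prop :=
  letI : MeasurableSpace H := borel H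
  ∃ ν : Measure H, ν.IsHaarMeasure ∧ ∃ ψ : L2 d, ψ ≠ 0 ∧
    MemLp (fun p : EuclideanSpace ℝ (Fin d) × H =>
        ⟪ψ, quasiRegular p.1 (p.2 : GL (Fin d) ℝ) ψ⟫_ℂ) 2
      (((volume : Measure (EuclideanSpace ℝ (Fin d))).prod ν).withDensity fun p =>
        ENNReal.ofReal |((p.2 : GL (Fin d) ℝ) : Matrix (Fin d) (Fin d) ℝ).det|⁻¹)

/-- Irreducibly admissible dilation groups: closed matrix groups whose quasi-regular
representation is irreducible and square-integrable. -/
structure IsIrreduciblyAdmissible {d : ℕ} (H : Subgroup (GL (Fin d) ℝ)) : Prop where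
  isClosed : IsClosed (H : Set (GL (Fin d) ℝ))
  irreducible : QuasiRegularIrreducible H
  squareIntegrable : QuasiRegularSquareIntegrable H

/-! ### Shearing subgroups -/

/-- `g` lies in the group `T(d,ℝ)` of upper triangular matrices with ones on the diagonal. -/
def IsUnipotent {d : ℕ} (g : GL (Fin d) ℝ) : Prop :=
  (∀ i j, j < i → (g : Matrix (Fin d) (Fin d) ℝ) i j = 0) ∧
    ∀ i, (g : Matrix (Fin d) (Fin d) ℝ) i i = 1

/-- `S` and `D` are closed subgroups of `H` exhibiting `H` as a generalized shearlet dilation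
group with shearing subgroup `S` and scaling subgroup `D`. -/
structure IsShearletDecomposition {d : ℕ} (H S D : Subgroup (GL (Fin d) ℝ)) : Prop where
  admissible : IsIrreduciblyAdmissible H
  shear_le : S ≤ H
  scale_le : D ≤ H
  isClosed_shear : IsClosed (S : Set (GL (Fin d) ℝ))
  isClosed_scale : IsClosed (D : Set (GL (Fin d) ℝ))
  /-- `S` is a connected abelian subgroup of `T(d,ℝ)`. -/
  isConnected_shear : IsConnected (S : Set (GL (Fin d) ℝ))
  comm_shear : ∀ g ∈ S, ∀ h ∈ S, g * h = h * g
  unipotent_shear : ∀ g ∈ S, IsUnipotent g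
  /-- `D` is a one-parameter group with a diagonal generator. -/
  scale_eq : ∃ Y : Fin d → ℝ, ∀ g : GL (Fin d) ℝ,
    g ∈ D ↔ ∃ r : ℝ, (g : Matrix (Fin d) (Fin d) ℝ) = NormedSpace.exp (r • Matrix.diagonal Y)
  /-- Every `h ∈ H` is uniquely of the form `± δ s` with `δ ∈ D` and `s ∈ S`. -/
  existsUnique_factor : ∀ h ∈ H, ∃! p : ℤˣ × GL (Fin d) ℝ × GL (Fin d) ℝ,
    p.2.1 ∈ D ∧ p.2.2 ∈ S ∧
      (h : Matrix (Fin d) (Fin d) ℝ) = ((p.1 : ℤ) : ℝ) •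
        ((p.2.1 : Matrix (Fin d) (Fin d) ℝ) * (p.2.2 : Matrix (Fin d) (Fin d) ℝ))

/-- `S` is the shearing subgroup of some generalized shearlet dilation group. -/
def IsShearingSubgroup {d : ℕ} (S : Subgroup (GL (Fin d) ℝ)) : Prop :=
  ∃ H D : Subgroup (GL (Fin d) ℝ), IsShearletDecomposition H S D

/-- The Lie algebra of a matrix group: all `X` with `exp (ℝ X) ⊆ H`. -/
def lieAlgebra {d : ℕ} (H : Subgroup (GL (Fin d) ℝ)) : Set (Matrix (Fin d) (Fin d) ℝ) :=
  {X | ∀ r : ℝ, ∃ g ∈ H, (g : Matrix (Fin d) (Fin d) ℝ) = NormedSpace.exp (r • X)}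

/-- `(X i)_{i ≠ 0}` is a basis of `𝔰` with `(X i)ᵀ e₁ = e_i` (indices start at `0` here, so `e₁`
is the basis vector with index `0`). -/
structure IsAdaptedBasis {d : ℕ} [NeZero d] (𝔰 : Set (Matrix (Fin d) (Fin d) ℝ))
    (X : {i : Fin d // i ≠ 0} → Matrix (Fin d) (Fin d) ℝ) : Prop where
  linearIndependent : LinearIndependent ℝ X
  span_eq : (Submodule.span ℝ (Set.range X) : Set (Matrix (Fin d) (Fin d) ℝ)) = 𝔰
  transpose_mulVec : ∀ i, (X i)ᵀ *ᵥ Pi.single 0 1 = Pi.single i.1 1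

/-- The canonical basis of `𝔰`: the unique basis `(X i)_{i ≠ 0}` of `𝔰` with
`(X i)ᵀ e₁ = e_i`. -/
def IsCanonicalBasis {d : ℕ} [NeZero d] (𝔰 : Set (Matrix (Fin d) (Fin d) ℝ))
    (X : {i : Fin d // i ≠ 0} → Matrix (Fin d) (Fin d) ℝ) : Prop :=
  IsAdaptedBasis 𝔰 X ∧ ∀ X', IsAdaptedBasis 𝔰 X' → X' = X

/-! ### Irreducible algebras and Jordan–Hölder bases -/

/-- The nilradical of a commutative real algebra, as a real subspace. -/
def nilrad (A : Type*) [CommRing A] [Algebra ℝ A] : Submodule ℝ A :=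
  (nilradical A).restrictScalars ℝ

/-- `A` is irreducible over `ℝ`: it is the direct sum of `ℝ · 1` and its nilradical. -/
def IsIrreducibleAlgebra (A : Type*) [CommRing A] [Algebra ℝ A] : Prop :=
  IsCompl (Submodule.span ℝ {(1 : A)}) (nilrad A)

/-- The span of the `a j` with (zero-based) index `j ≥ m`. -/
def tailSpan {A : Type*} [CommRing A] [Algebra ℝ A] {d : ℕ} (a : Fin d → A) (m : ℕ) :
    Submodule ℝ A :=
  Submodule.span ℝ (a '' {j | m ≤ (j : ℕ)})

/-- `(a i)_{i ≠ 0}` is a Jordan–Hölder basis of the nilradical `𝒩`: it is a basis of `𝒩`, and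
multiplication by `𝒩` maps the span of `a m, a (m+1), …` into that of `a (m+1), a (m+2), …`,
for all zero-based indices `m` with `m + 1 < d`. -/
structure IsJordanHolderBasis {A : Type*} [CommRing A] [Algebra ℝ A] {d : ℕ} [NeZero d]
    (a : Fin d → A) : Prop where
  linearIndependent : LinearIndependent ℝ fun i : {i : Fin d // i ≠ 0} => a i
  span_eq : Submodule.span ℝ (Set.range fun i : {i : Fin d // i ≠ 0} => a i) = nilrad A
  mul_mem : ∀ m : ℕ, m + 1 < d → ∀ x ∈ nilrad A, ∀ y ∈ tailSpan a m,
    x * y ∈ tailSpan a (m + 1)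

end Shearlet

namespace Shearlet

open scoped FourierTransform SchwartzMap

variable {d : ℕ}

/-! Take `H` to be all invertible matrices `Ψ(x)ᵀ`, a copy of the unit group of `A`. Since `A = ℝ·1
⊕ 𝒩`, the units are `ℝˣ·(1 + 𝒩)`: the signs and positive scalars give `±D`, and `1 + 𝒩` gives `S`.
The transpose of `h ∈ H` acts on `ℝ^d` as multiplication by a unit of `A`. This dual action has one
conull open orbit, the units themselves (the complement of a hyperplane), and trivial stabilizers
there.

On the Fourier side `π(x,h)` is a dilation by `hᵀ` times a character, so a matrix coefficient is, in
`x`, a Fourier transform of a product (`inner_quasiRegular`). Injectivity of the Fourier transform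
and commutativity of the product give irreducibility (`quasiRegularIrreducible_of_mul`). Plancherel
and a bump function near the unit element, whose translates back to its support involve only a
compact set of `h`, give square-integrability (`quasiRegularSquareIntegrable_of_mul`).

The rest is linear algebra. A Jordan–Hölder basis makes `𝒩` act strictly triangularly
(`IsJordanHolderBasis.isTriangularBasis`). Exponentials of `Ψ(𝒩)ᵀ` stay in `1 + Ψ(𝒩)ᵀ`, and
differentiating at `0` gives the converse (`lieAlgebra_shearGroup`). As the first basis vector is
`1`, the vector `Ψ(x)e₁` is the coordinate vector of `x`, which forces the canonical basis. -/

/-! ### Linear changes of variables on `ℝ^d`. -/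

theorem det_toEuclideanLin (M : Matrix (Fin d) (Fin d) ℝ) :
    LinearMap.det (Matrix.toEuclideanLin M) = M.det := by
  rw [← LinearMap.det_toMatrix (EuclideanSpace.basisFun (Fin d) ℝ).toBasis]
  congr 1
  ext i j
  simp [LinearMap.toMatrix_apply]

theorem continuous_toEuclideanLin (M : Matrix (Fin d) (Fin d) ℝ) :
    Continuous (Matrix.toEuclideanLin M) :=
  LinearMap.continuous_of_finiteDimensional _

theorem toEuclideanLin_mul_apply (M N : Matrix (Fin d) (Fin d) ℝ) (v : EuclideanSpace ℝ (Fin d)) :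
    Matrix.toEuclideanLin (M * N) v = Matrix.toEuclideanLin M (Matrix.toEuclideanLin N v) := by
  ext i
  simp [Matrix.mulVec_mulVec]

theorem toEuclideanLin_one_apply (v : EuclideanSpace ℝ (Fin d)) :
    Matrix.toEuclideanLin (1 : Matrix (Fin d) (Fin d) ℝ) v = v := by
  ext i
  simp

theorem det_coe_ne_zero (h : GL (Fin d) ℝ) : (h : Matrix (Fin d) (Fin d) ℝ).det ≠ 0 :=
  ((Matrix.isUnit_iff_isUnit_det _).1 h.isUnit).ne_zero

theorem map_toEuclideanLin_volume {M : Matrix (Fin d) (Fin d) ℝ} (hM : M.det ≠ 0) :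
    Measure.map (Matrix.toEuclideanLin M) (volume : Measure (EuclideanSpace ℝ (Fin d))) =
      ENNReal.ofReal |M.det|⁻¹ • volume := by
  rw [Measure.map_linearMap_addHaar_eq_smul_addHaar volume (by rwa [det_toEuclideanLin]),
    det_toEuclideanLin, abs_inv]

theorem measurableEmbedding_toEuclideanLin {M : Matrix (Fin d) (Fin d) ℝ} (hM : M.det ≠ 0) :
    MeasurableEmbedding (Matrix.toEuclideanLin M) :=
  (continuous_toEuclideanLin M).measurableEmbedding
    (LinearMap.equivOfDetNeZero (Matrix.toEuclideanLin M)
      (by rwa [det_toEuclideanLin])).injective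

theorem lintegral_comp_toEuclideanLin {M : Matrix (Fin d) (Fin d) ℝ} (hM : M.det ≠ 0)
    (F : EuclideanSpace ℝ (Fin d) → ENNReal) :
    ∫⁻ x, F (Matrix.toEuclideanLin M x) = ENNReal.ofReal |M.det|⁻¹ * ∫⁻ x, F x := by
  rw [← (measurableEmbedding_toEuclideanLin hM).lintegral_map, map_toEuclideanLin_volume hM,
    lintegral_smul_measure, smul_eq_mul]

theorem integral_comp_toEuclideanLin {V : Type*} [NormedAddCommGroup V] [NormedSpace ℝ V]
    {M : Matrix (Fin d) (Fin d) ℝ} (hM : M.det ≠ 0) (F : EuclideanSpace ℝ (Fin d) → V) :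
    ∫ x, F (Matrix.toEuclideanLin M x) = |M.det|⁻¹ • ∫ x, F x := by
  rw [← (measurableEmbedding_toEuclideanLin hM).integral_map, map_toEuclideanLin_volume hM,
    integral_smul_measure, ENNReal.toReal_ofReal (by positivity)]

theorem quasiMeasurePreserving_toEuclideanLin {M : Matrix (Fin d) (Fin d) ℝ} (hM : M.det ≠ 0) :
    Measure.QuasiMeasurePreserving (Matrix.toEuclideanLin M)
      (volume : Measure (EuclideanSpace ℝ (Fin d))) volume :=
  ⟨(continuous_toEuclideanLin M).measurable, by
    rw [map_toEuclideanLin_volume hM]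
    exact Measure.smul_absolutelyContinuous⟩

/-! ### The quasi-regular representation is isometric -/

theorem dilateFun_congr_ae (x : EuclideanSpace ℝ (Fin d)) (h : GL (Fin d) ℝ)
    {f g : EuclideanSpace ℝ (Fin d) → ℂ} (hfg : f =ᵐ[volume] g) :
    dilateFun x h f =ᵐ[volume] dilateFun x h g := by
  have h1 := ((quasiMeasurePreserving_toEuclideanLin (det_coe_ne_zero h⁻¹)).comp
    (measurePreserving_sub_right volume x).quasiMeasurePreserving).ae_eq_comp hfg
  filter_upwards [h1] with y hy
  simp only [dilateFun]
  congr 1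

theorem coeFn_quasiRegular (x : EuclideanSpace ℝ (Fin d)) (h : GL (Fin d) ℝ) (f : L2 d) :
    quasiRegular x h f =ᵐ[volume] dilateFun x h f :=
  MemLp.coeFn_toLp _

theorem abs_det_inv (h : GL (Fin d) ℝ) :
    |((h⁻¹ : GL (Fin d) ℝ) : Matrix (Fin d) (Fin d) ℝ).det|⁻¹ =
      |(h : Matrix (Fin d) (Fin d) ℝ).det| := by
  rw [Matrix.coe_units_inv, Matrix.det_nonsing_inv, Ring.inverse_eq_inv', abs_inv, inv_inv]

theorem integral_norm_sq_dilateFun (x : EuclideanSpace ℝ (Fin d)) (h : GL (Fin d) ℝ)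
    (f : EuclideanSpace ℝ (Fin d) → ℂ) :
    ∫ y, ‖dilateFun x h f y‖ ^ 2 = ∫ y, ‖f y‖ ^ 2 := by
  have hd : 0 < |(h : Matrix (Fin d) (Fin d) ℝ).det| := abs_pos.2 (det_coe_ne_zero h)
  simp only [dilateFun, norm_mul, mul_pow]
  rw [integral_const_mul, integral_sub_right_eq_self
    (fun y => ‖f (Matrix.toEuclideanLin ((h⁻¹ : GL (Fin d) ℝ) : Matrix (Fin d) (Fin d) ℝ) y)‖ ^ 2) x,
    integral_comp_toEuclideanLin (det_coe_ne_zero h⁻¹) (fun y => ‖f y‖ ^ 2), abs_det_inv,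
    smul_eq_mul, ← mul_assoc, Complex.norm_real, Real.norm_eq_abs, sq_abs, ← Real.rpow_natCast,
    ← Real.rpow_mul hd.le]
  norm_num
  rw [Real.rpow_neg_one, inv_mul_cancel₀ hd.ne', one_mul]

theorem norm_quasiRegular (x : EuclideanSpace ℝ (Fin d)) (h : GL (Fin d) ℝ) (f : L2 d) :
    ‖quasiRegular x h f‖ = ‖f‖ := by
  have key : ∀ g : L2 d, ‖g‖ ^ 2 = ∫ y, ‖g y‖ ^ 2 := fun g => by
    have := L2.inner_def (𝕜 := ℂ) g g
    rw [inner_self_eq_norm_sq_to_K] at this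
    simp only [inner_self_eq_norm_sq_to_K] at this
    apply Complex.ofReal_injective
    rw [← integral_complex_ofReal]
    simpa using this
  rw [← sq_eq_sq₀ (norm_nonneg _) (norm_nonneg _), key, key, ← integral_norm_sq_dilateFun x h f]
  apply integral_congr_ae
  filter_upwards [coeFn_quasiRegular x h f] with y hy
  rw [hy]

theorem quasiRegular_sub (x : EuclideanSpace ℝ (Fin d)) (h : GL (Fin d) ℝ) (f g : L2 d) :
    quasiRegular x h (f - g) = quasiRegular x h f - quasiRegular x h g := by
  apply Lp.ext
  filter_upwards [coeFn_quasiRegular x h (f - g), coeFn_quasiRegular x h f,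
    coeFn_quasiRegular x h g, Lp.coeFn_sub (quasiRegular x h f) (quasiRegular x h g),
    dilateFun_congr_ae x h (Lp.coeFn_sub f g)] with y h1 h2 h3 h4 h5
  rw [h1, h4, h5, Pi.sub_apply, h2, h3]
  simp only [dilateFun, Pi.sub_apply, mul_sub]

theorem isometry_quasiRegular (x : EuclideanSpace ℝ (Fin d)) (h : GL (Fin d) ℝ) :
    Isometry (quasiRegular x h : L2 d → L2 d) :=
  Isometry.of_dist_eq fun f g => by
    rw [dist_eq_norm, ← quasiRegular_sub, norm_quasiRegular, dist_eq_norm]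

/-! ### The quasi-regular representation on the Fourier side -/

/-- The inverse transpose of `h`. -/
def contragredient (h : GL (Fin d) ℝ) : GL (Fin d) ℝ where
  val := ((h⁻¹ : GL (Fin d) ℝ) : Matrix (Fin d) (Fin d) ℝ)ᵀ
  inv := (h : Matrix (Fin d) (Fin d) ℝ)ᵀ
  val_inv := by rw [← Matrix.transpose_mul, ← Units.val_mul, mul_inv_cancel]; simp
  inv_val := by rw [← Matrix.transpose_mul, ← Units.val_mul, inv_mul_cancel]; simp

theorem dilateFun_contragredient (h : GL (Fin d) ℝ) (f : EuclideanSpace ℝ (Fin d) → ℂ)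
    (ξ : EuclideanSpace ℝ (Fin d)) :
    dilateFun 0 (contragredient h) f ξ =
      ((|(h : Matrix (Fin d) (Fin d) ℝ).det| ^ (1 / 2 : ℝ) : ℝ) : ℂ) *
        f (Matrix.toEuclideanLin (h : Matrix (Fin d) (Fin d) ℝ)ᵀ ξ) := by
  have h1 : |((contragredient h : GL (Fin d) ℝ) : Matrix (Fin d) (Fin d) ℝ).det| ^ (-(1 / 2) : ℝ)
      = |(h : Matrix (Fin d) (Fin d) ℝ).det| ^ (1 / 2 : ℝ) := by
    rw [Real.rpow_neg (abs_nonneg _), ← Real.inv_rpow (abs_nonneg _), contragredient,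
      Matrix.det_transpose, abs_det_inv]
  rw [dilateFun, h1, sub_zero]
  rfl

/-- Substitute `y = hz + x`: the phase splits into `-⟪ξ, x⟫` and `-⟪z, hᵀξ⟫`. The Jacobian `|det h|`
turns the normalization `|det h|^{-1/2}` into `|det h|^{1/2}`, which is the one belonging to the
contragredient. -/
theorem fourier_dilateFun (x : EuclideanSpace ℝ (Fin d)) (h : GL (Fin d) ℝ)
    (f : EuclideanSpace ℝ (Fin d) → ℂ) (ξ : EuclideanSpace ℝ (Fin d)) :
    𝓕 (dilateFun x h f) ξ =
      Real.fourierChar (-⟪ξ, x⟫_ℝ) • dilateFun 0 (contragredient h) (𝓕 f) ξ := by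
  have hd : 0 < |(h : Matrix (Fin d) (Fin d) ℝ).det| := abs_pos.2 (det_coe_ne_zero h)
  set c : ℂ := ((|(h : Matrix (Fin d) (Fin d) ℝ).det| ^ (-(1 / 2) : ℝ) : ℝ) : ℂ) with hc
  let G : EuclideanSpace ℝ (Fin d) → ℂ := fun z =>
    Real.fourierChar (-⟪Matrix.toEuclideanLin (h : Matrix (Fin d) (Fin d) ℝ) z + x, ξ⟫_ℝ) • (c * f z)
  have e1 : ∀ y, Real.fourierChar (-⟪y, ξ⟫_ℝ) • dilateFun x h f y =
      G (Matrix.toEuclideanLin ((h⁻¹ : GL (Fin d) ℝ) : Matrix (Fin d) (Fin d) ℝ) (y - x)) := by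
    intro y
    simp only [G, dilateFun]
    rw [← toEuclideanLin_mul_apply, ← Units.val_mul, mul_inv_cancel, Units.val_one,
      toEuclideanLin_one_apply, sub_add_cancel]
  have e2 : ∀ z, ⟪Matrix.toEuclideanLin (h : Matrix (Fin d) (Fin d) ℝ) z, ξ⟫_ℝ =
      ⟪z, Matrix.toEuclideanLin (h : Matrix (Fin d) (Fin d) ℝ)ᵀ ξ⟫_ℝ := by
    intro z
    simp only [EuclideanSpace.inner_eq_star_dotProduct, Matrix.toLpLin_apply, star_trivial]
    rw [Matrix.dotProduct_mulVec, Matrix.mulVec_transpose, dotProduct_comm]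
  rw [Real.fourier_eq]
  simp_rw [e1]
  rw [integral_sub_right_eq_self (fun y => G (Matrix.toEuclideanLin
    ((h⁻¹ : GL (Fin d) ℝ) : Matrix (Fin d) (Fin d) ℝ) y)) x,
    integral_comp_toEuclideanLin (det_coe_ne_zero h⁻¹) G, abs_det_inv, dilateFun_contragredient,
    Real.fourier_eq]
  have e3 : ∀ z, G z = (Real.fourierChar (-⟪ξ, x⟫_ℝ) * c) * (Real.fourierChar
      (-⟪z, Matrix.toEuclideanLin (h : Matrix (Fin d) (Fin d) ℝ)ᵀ ξ⟫_ℝ) • f z) := by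
    intro z
    simp only [G]
    rw [inner_add_left, e2, neg_add, AddChar.map_add_eq_mul, real_inner_comm ξ x, Circle.smul_def,
      Circle.smul_def, Circle.coe_mul]
    simp only [smul_eq_mul]
    ring
  simp_rw [e3]
  have hcd : ((|(h : Matrix (Fin d) (Fin d) ℝ).det| : ℝ) : ℂ) * c =
      ((|(h : Matrix (Fin d) (Fin d) ℝ).det| ^ (1 / 2 : ℝ) : ℝ) : ℂ) := by
    rw [hc, ← Complex.ofReal_mul]
    congr 1
    nth_rewrite 1 [← Real.rpow_one |(h : Matrix (Fin d) (Fin d) ℝ).det|]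
    rw [← Real.rpow_add hd]
    norm_num
  rw [integral_const_mul, Circle.smul_def, Complex.real_smul, smul_eq_mul, ← hcd]
  ring

theorem exists_schwartzMap_eq_dilateFun (x : EuclideanSpace ℝ (Fin d)) (h : GL (Fin d) ℝ)
    (f : 𝓢(EuclideanSpace ℝ (Fin d), ℂ)) :
    ∃ g : 𝓢(EuclideanSpace ℝ (Fin d), ℂ), ⇑g = dilateFun x h f := by
  have hdet : LinearMap.det (Matrix.toEuclideanLin
      ((h⁻¹ : GL (Fin d) ℝ) : Matrix (Fin d) (Fin d) ℝ)) ≠ 0 := by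
    rw [det_toEuclideanLin]
    exact det_coe_ne_zero h⁻¹
  refine ⟨((|(h : Matrix (Fin d) (Fin d) ℝ).det| ^ (-(1 / 2) : ℝ) : ℝ) : ℂ) •
    SchwartzMap.compSubConstCLM ℂ x (SchwartzMap.compCLMOfContinuousLinearEquiv ℂ
      (LinearMap.equivOfDetNeZero _ hdet).toContinuousLinearEquiv f), ?_⟩
  ext y
  simp [dilateFun]

theorem memLp_fourierChar_smul (x : EuclideanSpace ℝ (Fin d)) (g : L2 d) :
    MemLp (fun ξ => Real.fourierChar ⟪ξ, x⟫_ℝ • g ξ) 2 volume := by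
  refine (memLp_congr_norm ?_ (Lp.memLp g).1 (Filter.Eventually.of_forall fun ξ => ?_)).2
    (Lp.memLp g)
  · refine AEStronglyMeasurable.smul (Continuous.aestronglyMeasurable ?_) (Lp.memLp g).1
    have hc : Continuous fun ξ : EuclideanSpace ℝ (Fin d) => ⟪ξ, x⟫_ℝ := by fun_prop
    exact continuous_subtype_val.comp (Real.continuous_fourierChar.comp hc)
  · exact Circle.norm_smul _ _

/-- On Schwartz functions this is the pointwise formula `fourier_dilateFun`; both sides are
continuous in `f`, so density extends it to `L²`. The character sits on `g`, conjugated, so that no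
modulation operator on `L²` is needed. -/
theorem inner_fourier_quasiRegular (x : EuclideanSpace ℝ (Fin d)) (h : GL (Fin d) ℝ)
    (g f : L2 d) :
    ⟪g, 𝓕 (quasiRegular x h f)⟫_ℂ =
      ⟪(memLp_fourierChar_smul x g).toLp _, quasiRegular 0 (contragredient h) (𝓕 f)⟫_ℂ := by
  refine DenseRange.induction_on
    (p := fun f : L2 d => ⟪g, 𝓕 (quasiRegular x h f)⟫_ℂ =
      ⟪(memLp_fourierChar_smul x g).toLp _, quasiRegular 0 (contragredient h) (𝓕 f)⟫_ℂ)
    (SchwartzMap.denseRange_toLpCLM (p := 2) (F := ℂ) (μ := volume) ENNReal.ofNat_ne_top) f ?_ ?_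
  · have hF : Continuous fun f : L2 d => 𝓕 f :=
      (Lp.fourierTransformₗᵢ (EuclideanSpace ℝ (Fin d)) ℂ).continuous
    exact isClosed_eq (continuous_const.inner (hF.comp (isometry_quasiRegular x h).continuous))
      (continuous_const.inner ((isometry_quasiRegular 0 (contragredient h)).continuous.comp hF))
  · intro f
    obtain ⟨f', hf'⟩ := exists_schwartzMap_eq_dilateFun x h f
    have h1 : quasiRegular x h (f.toLp 2) = f'.toLp 2 := by
      apply Lp.ext
      filter_upwards [coeFn_quasiRegular x h (f.toLp 2), f'.coeFn_toLp 2,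
        dilateFun_congr_ae x h (f.coeFn_toLp 2)] with y e1 e2 e3
      rw [e1, e2, e3, hf']
    rw [SchwartzMap.toLpCLM_apply, h1, SchwartzMap.toLp_fourier_eq, SchwartzMap.toLp_fourier_eq,
      L2.inner_def, L2.inner_def]
    apply integral_congr_ae
    filter_upwards [(𝓕 f').coeFn_toLp 2, (memLp_fourierChar_smul x g).coeFn_toLp,
      coeFn_quasiRegular 0 (contragredient h) ((𝓕 f).toLp 2),
      dilateFun_congr_ae 0 (contragredient h) ((𝓕 f).coeFn_toLp 2)] with ξ e1 e2 e3 e4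
    rw [e1, e2, e3, e4, SchwartzMap.fourier_coe, hf', fourier_dilateFun, SchwartzMap.fourier_coe]
    simp only [Circle.smul_def, smul_eq_mul, RCLike.inner_apply, map_mul, AddChar.map_neg_eq_inv,
      Circle.coe_inv_eq_conj]
    ring

/-- Plancherel moves the inner product to the Fourier side, where `x` enters only through a
character. Both irreducibility and square-integrability start from this formula. -/
theorem inner_quasiRegular (x : EuclideanSpace ℝ (Fin d)) (h : GL (Fin d) ℝ) (g f : L2 d) :
    ⟪g, quasiRegular x h f⟫_ℂ =
      𝓕 (fun ξ => (starRingEnd ℂ) ((𝓕 g : L2 d) ξ) *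
        dilateFun 0 (contragredient h) (𝓕 f : L2 d) ξ) x := by
  rw [← Lp.inner_fourier_eq, inner_fourier_quasiRegular, L2.inner_def, Real.fourier_eq]
  apply integral_congr_ae
  filter_upwards [(memLp_fourierChar_smul x (𝓕 g)).coeFn_toLp,
    coeFn_quasiRegular 0 (contragredient h) (𝓕 f)] with ξ e1 e2
  rw [e1, e2]
  simp only [Circle.smul_def, smul_eq_mul, RCLike.inner_apply, map_mul, AddChar.map_neg_eq_inv,
      Circle.coe_inv_eq_conj]
  ring

/-- Every test function is the Fourier transform of a Schwartz function, and self-adjointness of the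
transform moves it onto `u`; so `u` integrates to zero against all test functions. -/
theorem ae_eq_zero_of_fourier_eq_zero {u : EuclideanSpace ℝ (Fin d) → ℂ} (hu : Integrable u)
    (h : ∀ x, 𝓕 u x = 0) : u =ᵐ[volume] 0 := by
  refine ae_eq_zero_of_integral_contDiff_smul_eq_zero hu.locallyIntegrable fun φ hφ hφc => ?_
  have hc : HasCompactSupport fun x => (φ x : ℂ) := hφc.comp_left Complex.ofReal_zero
  let Φ : 𝓢(EuclideanSpace ℝ (Fin d), ℂ) :=
    hc.toSchwartzMap (Complex.ofRealCLM.contDiff.comp hφ)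
  have key := VectorFourier.integral_fourierIntegral_smul_eq_flip
    (L := innerₗ (EuclideanSpace ℝ (Fin d))) Real.continuous_fourierChar continuous_inner
    (𝓕⁻ Φ : 𝓢(EuclideanSpace ℝ (Fin d), ℂ)).integrable (μ := volume) (ν := volume) hu
  rw [flip_innerₗ] at key
  have e1 : ∀ ξ, VectorFourier.fourierIntegral Real.fourierChar volume
      (innerₗ (EuclideanSpace ℝ (Fin d))) (𝓕⁻ Φ : 𝓢(EuclideanSpace ℝ (Fin d), ℂ)) ξ = Φ ξ := by
    intro ξ
    change (𝓕 (𝓕⁻ Φ) : 𝓢(EuclideanSpace ℝ (Fin d), ℂ)) ξ = Φ ξ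
    rw [FourierTransform.fourier_fourierInv_eq]
  have e2 : ∀ ξ, VectorFourier.fourierIntegral Real.fourierChar volume
      (innerₗ (EuclideanSpace ℝ (Fin d))) u ξ = 0 := h
  simp only [e1, e2, smul_zero, integral_zero] at key
  rw [← key]
  rfl

end Shearlet

namespace Shearlet

open scoped FourierTransform SchwartzMap

variable {d : ℕ}

/-! ### Irreducibility -/

theorem _root_.Continuous.toEuclideanLin_apply {X : Type*} [TopologicalSpace X]
    {M : X → Matrix (Fin d) (Fin d) ℝ} {v : X → EuclideanSpace ℝ (Fin d)}
    (hM : Continuous M) (hv : Continuous v) :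
    Continuous fun x => Matrix.toEuclideanLin (M x) (v x) :=
  (PiLp.continuous_toLp 2 _).comp (hM.matrix_mulVec ((PiLp.continuous_ofLp 2 _).comp hv))

theorem inner_quasiRegular_eq_zero {h : GL (Fin d) ℝ} {f g : L2 d}
    (H : ∀ x, ⟪g, quasiRegular x h f⟫_ℂ = 0) :
    ∀ᵐ ξ, (𝓕 g : L2 d) ξ = 0 ∨
      (𝓕 f : L2 d) (Matrix.toEuclideanLin (h : Matrix (Fin d) (Fin d) ℝ)ᵀ ξ) = 0 := by
  have hint : Integrable fun ξ => (starRingEnd ℂ) ((𝓕 g : L2 d) ξ) *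
      dilateFun 0 (contragredient h) (𝓕 f : L2 d) ξ :=
    (Lp.memLp (𝓕 g : L2 d)).star.integrable_mul
      (dilateFun_memLp 0 (contragredient h) (Lp.memLp (𝓕 f : L2 d)))
  have h0 := ae_eq_zero_of_fourier_eq_zero hint fun x => by rw [← inner_quasiRegular, H]
  filter_upwards [h0] with ξ hξ
  have hc : ((|(h : Matrix (Fin d) (Fin d) ℝ).det| ^ (1 / 2 : ℝ) : ℝ) : ℂ) ≠ 0 :=
    Complex.ofReal_ne_zero.2 (Real.rpow_pos_of_pos (abs_pos.2 (det_coe_ne_zero h)) _).ne'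
  rw [dilateFun_contragredient, Pi.zero_apply, mul_eq_zero, mul_eq_zero, map_eq_zero] at hξ
  exact hξ.imp_right fun h' => h'.resolve_left hc

/-- The integral may be infinite, as `q` is only in `L²`; being nonzero is all that the
irreducibility argument uses. -/
theorem lintegral_enorm_ne_zero {q : L2 d} (hq : q ≠ 0) : ∫⁻ ξ, ‖q ξ‖ₑ ≠ 0 := by
  rw [Ne, lintegral_eq_zero_iff' (Lp.memLp q).1.enorm]
  intro h0
  refine hq (Lp.ext ?_)
  filter_upwards [h0, Lp.coeFn_zero ℂ 2 volume] with ξ h1 h2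
  rw [h2]
  simpa using h1

/-- If the transposed action of `H` comes from a commutative product on `ℝ^d` almost all of whose
elements act invertibly, then the quasi-regular representation is irreducible. -/
theorem quasiRegularIrreducible_of_mul {H : Subgroup (GL (Fin d) ℝ)}
    (L : EuclideanSpace ℝ (Fin d) →ₗ[ℝ] Matrix (Fin d) (Fin d) ℝ)
    (hcomm : ∀ z w, Matrix.toEuclideanLin (L z) w = Matrix.toEuclideanLin (L w) z)
    (hnull : ∀ᵐ z, (L z).det ≠ 0)
    (hH : ∀ z, (L z).det ≠ 0 → ∃ h ∈ H, (h : Matrix (Fin d) (Fin d) ℝ) = (L z)ᵀ) :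
    QuasiRegularIrreducible H := by
  intro K hK hinv
  by_contra! hcon
  obtain ⟨f, hfK, hf⟩ := K.ne_bot_iff.1 hcon.1
  have : CompleteSpace K := hK.completeSpace_coe
  obtain ⟨g, hgK, hg⟩ := Kᗮ.ne_bot_iff.1 (mt Submodule.orthogonal_eq_bot_iff.1 hcon.2)
  have hp : (𝓕 g : L2 d) ≠ 0 := fun h0 => hg ((Lp.fourierTransformₗᵢ _ ℂ).map_eq_zero_iff.1 h0)
  have hq : (𝓕 f : L2 d) ≠ 0 := fun h0 => hf ((Lp.fourierTransformₗᵢ _ ℂ).map_eq_zero_iff.1 h0)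
  generalize hpg : (𝓕 g : L2 d) = p at hp
  generalize hqf : (𝓕 f : L2 d) = q at hq
  have hpm : Measurable fun ξ => ‖p ξ‖ₑ := (Lp.stronglyMeasurable p).measurable.enorm
  have hqm : Measurable fun ξ => ‖q ξ‖ₑ := (Lp.stronglyMeasurable q).measurable.enorm
  have hLc : Continuous L := L.continuous_of_finiteDimensional
  have hLm : Measurable fun w : EuclideanSpace ℝ (Fin d) × EuclideanSpace ℝ (Fin d) =>
      Matrix.toEuclideanLin (L w.1) w.2 :=
    ((hLc.comp continuous_fst).toEuclideanLin_apply continuous_snd).measurable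
  -- For each invertible `L z` the integrand vanishes for almost all `ξ`, with a null set depending
  -- on `z`. Integrating over `z` as well lets Tonelli exchange the two quantifiers.
  have h0 : ∫⁻ z, ∫⁻ ξ, ‖p ξ‖ₑ * ‖q (Matrix.toEuclideanLin (L z) ξ)‖ₑ = 0 := by
    rw [← lintegral_zero (μ := (volume : Measure (EuclideanSpace ℝ (Fin d))))]
    refine lintegral_congr_ae ?_
    filter_upwards [hnull] with z hz
    obtain ⟨h, hhH, hh⟩ := hH z hz
    rw [← lintegral_zero (μ := (volume : Measure (EuclideanSpace ℝ (Fin d))))]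
    refine lintegral_congr_ae ?_
    have := inner_quasiRegular_eq_zero (h := h) (f := f) (g := g) fun x =>
      Submodule.inner_left_of_mem_orthogonal (hinv x h hhH f hfK) hgK
    rw [hpg, hqf, hh, Matrix.transpose_transpose] at this
    filter_upwards [this] with ξ hξ
    rcases hξ with hξ | hξ <;> simp [hξ]
  rw [lintegral_lintegral_swap ((hpm.comp measurable_snd).mul (hqm.comp hLm)).aemeasurable] at h0
  have h1 : ∀ᵐ ξ, ∫⁻ z, ‖p ξ‖ₑ * ‖q (Matrix.toEuclideanLin (L z) ξ)‖ₑ = 0 := by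
    refine (lintegral_eq_zero_iff ?_).1 h0
    exact ((hpm.comp measurable_fst).mul
      (hqm.comp (hLm.comp measurable_swap))).lintegral_prod_right'
  refine hp (Lp.ext ?_)
  filter_upwards [h1, hnull, Lp.coeFn_zero ℂ 2 volume] with ξ h2 h3 h4
  rw [h4]
  -- Commutativity makes `z ↦ L(z)ξ` the linear map `L ξ`, invertible for almost every `ξ`. The
  -- inner integral is then a nonzero constant times `∫ ‖q‖`, which forces `p ξ = 0`.
  simp_rw [fun z => hcomm z ξ] at h2
  rw [lintegral_const_mul' _ _ enorm_ne_top,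
    lintegral_comp_toEuclideanLin h3 fun z => ‖q z‖ₑ] at h2
  have h5 : ENNReal.ofReal |(L ξ).det|⁻¹ ≠ 0 := by simpa using h3
  simpa [h5, lintegral_enorm_ne_zero hq] using h2

end Shearlet

namespace Shearlet

open scoped FourierTransform SchwartzMap ContDiff

variable {d : ℕ}

/-! ### Topology of `GL(d, ℝ)` -/

attribute [local instance] Matrix.linftyOpNormedRing Matrix.linftyOpNormedAlgebra in
theorem isOpenEmbedding_coe_GL : Topology.IsOpenEmbedding
    (fun g : GL (Fin d) ℝ => (g : Matrix (Fin d) (Fin d) ℝ)) :=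
  Units.isOpenEmbedding_val (R := Matrix (Fin d) (Fin d) ℝ)

instance : LocallyCompactSpace (Matrix (Fin d) (Fin d) ℝ) :=
  inferInstanceAs (LocallyCompactSpace (Fin d → Fin d → ℝ))

instance : SecondCountableTopology (Matrix (Fin d) (Fin d) ℝ) :=
  inferInstanceAs (SecondCountableTopology (Fin d → Fin d → ℝ))

instance : LocallyCompactSpace (GL (Fin d) ℝ) :=
  isOpenEmbedding_coe_GL.locallyCompactSpace

instance : SecondCountableTopology (GL (Fin d) ℝ) :=
  isOpenEmbedding_coe_GL.isEmbedding.secondCountableTopology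

/-! ### Square-integrability -/

theorem lintegral_enorm_sq_fourier (u : 𝓢(EuclideanSpace ℝ (Fin d), ℂ)) :
    ∫⁻ x, ‖𝓕 (u : EuclideanSpace ℝ (Fin d) → ℂ) x‖ₑ ^ 2 = ENNReal.ofReal (∫ x, ‖u x‖ ^ 2) := by
  rw [← SchwartzMap.integral_norm_sq_fourier, ofReal_integral_eq_lintegral_ofReal
    ((memLp_two_iff_integrable_sq_norm (𝓕 u).continuous.aestronglyMeasurable).1 ((𝓕 u).memLp 2))
    (Filter.Eventually.of_forall fun x => by positivity)]
  refine lintegral_congr fun x => ?_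
  rw [ENNReal.ofReal_pow (norm_nonneg _), ofReal_norm, SchwartzMap.fourier_coe]

theorem continuous_fourierChar_smul_dilateFun {φ : EuclideanSpace ℝ (Fin d) → ℂ}
    (hφ : Continuous φ) {X : Type*} [TopologicalSpace X] {h : X → GL (Fin d) ℝ}
    {x ξ : X → EuclideanSpace ℝ (Fin d)} (hh : Continuous h) (hx : Continuous x)
    (hξ : Continuous ξ) :
    Continuous fun q => Real.fourierChar (-⟪ξ q, x q⟫_ℝ) • ((starRingEnd ℂ) (φ (ξ q)) *
      dilateFun 0 (contragredient (h q)) φ (ξ q)) := by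
  simp only [dilateFun_contragredient, Circle.smul_def, smul_eq_mul]
  have hval : Continuous fun q => ((h q : GL (Fin d) ℝ) : Matrix (Fin d) (Fin d) ℝ) :=
    Units.continuous_val.comp hh
  have hi : Continuous fun q => -⟪ξ q, x q⟫_ℝ := (hξ.inner hx).neg
  have h1 : Continuous fun q => (Real.fourierChar (-⟪ξ q, x q⟫_ℝ) : ℂ) :=
    continuous_subtype_val.comp (Real.continuous_fourierChar.comp hi)
  have h2 : Continuous fun q => |(h q : Matrix (Fin d) (Fin d) ℝ).det| ^ (1 / 2 : ℝ) :=
    hval.matrix_det.abs.rpow_const fun q => Or.inr (by norm_num)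
  have h3 : Continuous fun q =>
      Matrix.toEuclideanLin (h q : Matrix (Fin d) (Fin d) ℝ)ᵀ (ξ q) :=
    hval.matrix_transpose.toEuclideanLin_apply hξ
  have h4 : Continuous fun q => (starRingEnd ℂ) (φ (ξ q)) :=
    Complex.continuous_conj.comp (hφ.comp hξ)
  have h5 : Continuous fun q => φ (Matrix.toEuclideanLin (h q : Matrix (Fin d) (Fin d) ℝ)ᵀ (ξ q)) :=
    hφ.comp h3
  exact h1.mul (h4.mul ((Complex.continuous_ofReal.comp h2).mul h5))

/-- The integrand of the Fourier integral is jointly continuous in `x`, `h` and `ξ`, so integrating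
out `ξ` leaves a measurable function. -/
theorem measurable_fourier_conj_mul_dilateFun {H : Subgroup (GL (Fin d) ℝ)} [MeasurableSpace H]
    [BorelSpace H] {φ : EuclideanSpace ℝ (Fin d) → ℂ} (hφ : Continuous φ) :
    Measurable fun p : EuclideanSpace ℝ (Fin d) × H =>
      𝓕 (fun ξ => (starRingEnd ℂ) (φ ξ) *
        dilateFun 0 (contragredient (p.2 : GL (Fin d) ℝ)) φ ξ) p.1 := by
  have hc : Continuous fun q : (EuclideanSpace ℝ (Fin d) × H) × EuclideanSpace ℝ (Fin d) =>
      Real.fourierChar (-⟪q.2, q.1.1⟫_ℝ) • ((starRingEnd ℂ) (φ q.2) *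
        dilateFun 0 (contragredient (q.1.2 : GL (Fin d) ℝ)) φ q.2) :=
    continuous_fourierChar_smul_dilateFun hφ
      (continuous_subtype_val.comp (continuous_snd.comp continuous_fst))
      (continuous_fst.comp continuous_fst) continuous_snd
  simp only [Real.fourier_eq]
  exact (hc.stronglyMeasurable.integral_prod_right (ν := volume)).measurable

theorem lintegral_fourier_conj_mul_dilateFun {φ : EuclideanSpace ℝ (Fin d) → ℝ}
    (hφ : ContDiff ℝ ∞ φ) (hφc : HasCompactSupport φ) (h : GL (Fin d) ℝ) :
    ∫⁻ x, ‖𝓕 (fun ξ => (starRingEnd ℂ) (φ ξ : ℂ) *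
      dilateFun 0 (contragredient h) (fun ξ => (φ ξ : ℂ)) ξ) x‖ₑ ^ 2 =
      ENNReal.ofReal (|(h : Matrix (Fin d) (Fin d) ℝ).det| * ∫ ξ, φ ξ ^ 2 *
        φ (Matrix.toEuclideanLin (h : Matrix (Fin d) (Fin d) ℝ)ᵀ ξ) ^ 2) := by
  set M := (h : Matrix (Fin d) (Fin d) ℝ) with hM
  let v : EuclideanSpace ℝ (Fin d) → ℝ := fun ξ =>
    φ ξ * (|M.det| ^ (1 / 2 : ℝ) * φ (Matrix.toEuclideanLin Mᵀ ξ))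
  have hMl : ContDiff ℝ ∞ (Matrix.toEuclideanLin Mᵀ) :=
    (LinearMap.toContinuousLinearMap (Matrix.toEuclideanLin Mᵀ)).contDiff
  have hvd : ContDiff ℝ ∞ v := hφ.mul (contDiff_const.mul (hφ.comp hMl))
  have hvc : HasCompactSupport v := hφc.mul_right
  have hvc' : HasCompactSupport fun ξ => (v ξ : ℂ) := hvc.comp_left Complex.ofReal_zero
  have key : ∫⁻ x, ‖𝓕 (fun ξ => (v ξ : ℂ)) x‖ₑ ^ 2 = ENNReal.ofReal (∫ ξ, ‖(v ξ : ℂ)‖ ^ 2) :=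
    lintegral_enorm_sq_fourier (hvc'.toSchwartzMap (Complex.ofRealCLM.contDiff.comp hvd))
  simp only [Complex.norm_real, Real.norm_eq_abs, sq_abs] at key
  have hu : (fun ξ => (starRingEnd ℂ) (φ ξ : ℂ) *
      dilateFun 0 (contragredient h) (fun ξ => (φ ξ : ℂ)) ξ) = fun ξ => (v ξ : ℂ) := by
    ext ξ
    simp only [v, dilateFun_contragredient, Complex.conj_ofReal, Complex.ofReal_mul, hM]
  rw [hu, ← integral_const_mul]
  refine key.trans (congrArg _ (integral_congr_ae (Filter.Eventually.of_forall fun ξ => ?_)))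
  simp only [v, mul_pow]
  rw [← Real.rpow_natCast (|M.det| ^ (1 / 2 : ℝ)), ← Real.rpow_mul (abs_nonneg _)]
  norm_num
  ring

/-- The density `|det h|⁻¹` of the left Haar measure cancels the determinant from Plancherel, and
the dilated factor is at most `1`. The bound is therefore uniform in `h`. -/
theorem lintegral_fourier_conj_mul_dilateFun_le {φ : EuclideanSpace ℝ (Fin d) → ℝ}
    (hφ : ContDiff ℝ ∞ φ) (hφc : HasCompactSupport φ) (hφ1 : ∀ ξ, |φ ξ| ≤ 1)
    (h : GL (Fin d) ℝ) :
    ENNReal.ofReal |(h : Matrix (Fin d) (Fin d) ℝ).det|⁻¹ *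
      ∫⁻ x, ‖𝓕 (fun ξ => (starRingEnd ℂ) (φ ξ : ℂ) *
        dilateFun 0 (contragredient h) (fun ξ => (φ ξ : ℂ)) ξ) x‖ₑ ^ 2 ≤
      ENNReal.ofReal (∫ ξ, φ ξ ^ 2) := by
  have hd : 0 < |(h : Matrix (Fin d) (Fin d) ℝ).det| := abs_pos.2 (det_coe_ne_zero h)
  have hB : Integrable fun ξ => φ ξ ^ 2 :=
    (hφ.continuous.pow 2).integrable_of_hasCompactSupport (by
      simp only [sq]
      exact hφc.mul_right)
  rw [lintegral_fourier_conj_mul_dilateFun hφ hφc, ← ENNReal.ofReal_mul (inv_nonneg.2 hd.le),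
    inv_mul_cancel_left₀ hd.ne']
  refine ENNReal.ofReal_le_ofReal (integral_mono_of_nonneg
    (Filter.Eventually.of_forall fun ξ => mul_nonneg (sq_nonneg _) (sq_nonneg _)) hB
    (Filter.Eventually.of_forall fun ξ => ?_))
  exact mul_le_of_le_one_right (sq_nonneg _) ((sq_le_one_iff_abs_le_one _).2 (hφ1 _))

/-- If `φ` is a test function with values in `[-1, 1]` such that only a compact set of `h ∈ H` maps
some point of its support back to its support, then the inverse Fourier transform of `φ` is an
admissible vector. -/
theorem quasiRegularSquareIntegrable_of_isCompact {H : Subgroup (GL (Fin d) ℝ)}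
    (hH : IsClosed (H : Set (GL (Fin d) ℝ))) {φ : EuclideanSpace ℝ (Fin d) → ℝ}
    (hφ : ContDiff ℝ ∞ φ) (hφc : HasCompactSupport φ) (hφ0 : φ ≠ 0)
    (hφ1 : ∀ ξ, |φ ξ| ≤ 1) {K : Set H} (hK : IsCompact K)
    (hφK : ∀ (h : H) (ξ : EuclideanSpace ℝ (Fin d)), φ ξ ≠ 0 →
      φ (Matrix.toEuclideanLin ((h : GL (Fin d) ℝ) : Matrix (Fin d) (Fin d) ℝ)ᵀ ξ) ≠ 0 → h ∈ K) :
    QuasiRegularSquareIntegrable H := by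
  let _ : MeasurableSpace H := borel H
  have : BorelSpace H := ⟨rfl⟩
  have : LocallyCompactSpace H := hH.isClosedEmbedding_subtypeVal.locallyCompactSpace
  have : SecondCountableTopology H := Topology.IsEmbedding.subtypeVal.secondCountableTopology
  have : SigmaCompactSpace H := inferInstance
  have hcs : HasCompactSupport fun x => (φ x : ℂ) := hφc.comp_left Complex.ofReal_zero
  let Φ : 𝓢(EuclideanSpace ℝ (Fin d), ℂ) :=
    hcs.toSchwartzMap (Complex.ofRealCLM.contDiff.comp hφ)
  have hΦ : ⇑Φ = fun ξ => (φ ξ : ℂ) := rfl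
  have hFψ : 𝓕 (𝓕⁻ (Φ.toLp 2) : L2 d) = Φ.toLp 2 := FourierTransform.fourier_fourierInv_eq _
  refine ⟨Measure.haar, inferInstance, 𝓕⁻ (Φ.toLp 2), ?_, ?_⟩
  · intro h0
    have h1 : Φ.toLp 2 = (0 : 𝓢(EuclideanSpace ℝ (Fin d), ℂ)).toLp 2 := by
      rw [← hFψ, h0]
      exact ((Lp.fourierTransformₗᵢ _ ℂ).map_zero).trans (map_zero
        (SchwartzMap.toLpCLM ℂ ℂ 2 (volume : Measure (EuclideanSpace ℝ (Fin d))))).symm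
    have h2 := SchwartzMap.injective_toLp 2 volume h1
    refine hφ0 (funext fun ξ => ?_)
    have h3 := DFunLike.congr_fun h2 ξ
    rw [hΦ] at h3
    exact Complex.ofReal_eq_zero.1 h3
  have hcoef : (fun p : EuclideanSpace ℝ (Fin d) × H =>
      ⟪(𝓕⁻ (Φ.toLp 2) : L2 d), quasiRegular p.1 (p.2 : GL (Fin d) ℝ) (𝓕⁻ (Φ.toLp 2))⟫_ℂ) =
        fun p => 𝓕 (fun ξ => (starRingEnd ℂ) (φ ξ : ℂ) *
          dilateFun 0 (contragredient (p.2 : GL (Fin d) ℝ)) (fun ξ => (φ ξ : ℂ)) ξ) p.1 := by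
    ext p
    rw [inner_quasiRegular, hFψ]
    refine Real.fourier_congr_ae ?_ _
    filter_upwards [Φ.coeFn_toLp 2, dilateFun_congr_ae 0 (contragredient (p.2 : GL (Fin d) ℝ))
      (Φ.coeFn_toLp 2)] with ξ e1 e2
    rw [e1, e2, hΦ]
  have hmeas := measurable_fourier_conj_mul_dilateFun (H := H) (φ := fun ξ => (φ ξ : ℂ))
    (Complex.continuous_ofReal.comp hφ.continuous)
  have hdetc : Continuous fun h : H =>
      ((h : GL (Fin d) ℝ) : Matrix (Fin d) (Fin d) ℝ).det :=
    (Units.continuous_val.comp continuous_subtype_val).matrix_det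
  have hdens : Measurable fun p : EuclideanSpace ℝ (Fin d) × H =>
      ENNReal.ofReal |((p.2 : GL (Fin d) ℝ) : Matrix (Fin d) (Fin d) ℝ).det|⁻¹ :=
    (hdetc.abs.measurable.comp measurable_snd).inv.ennreal_ofReal
  rw [hcoef]
  refine ⟨hmeas.aestronglyMeasurable, ?_⟩
  rw [eLpNorm_lt_top_iff_lintegral_rpow_enorm_lt_top two_ne_zero ENNReal.ofNat_ne_top]
  simp only [ENNReal.toReal_ofNat, ENNReal.rpow_ofNat]
  rw [lintegral_withDensity_eq_lintegral_mul _ hdens (hmeas.enorm.pow_const 2),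
    lintegral_prod_symm _ (hdens.mul (hmeas.enorm.pow_const 2)).aemeasurable]
  simp only [Pi.mul_apply]
  -- Outside `K` the two bumps have disjoint supports and the coefficient contributes nothing; on
  -- `K` the uniform bound applies, and `K` has finite Haar measure.
  calc _ ≤ ∫⁻ h : H, K.indicator (fun _ => ENNReal.ofReal (∫ ξ, φ ξ ^ 2)) h ∂Measure.haar := by
        refine lintegral_mono fun h => ?_
        simp only
        rw [lintegral_const_mul' _ _ ENNReal.ofReal_ne_top]
        by_cases hK' : h ∈ K
        · rw [Set.indicator_of_mem hK']
          exact lintegral_fourier_conj_mul_dilateFun_le hφ hφc hφ1 h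
        · have hz : ∀ ξ, φ ξ ^ 2 * φ (Matrix.toEuclideanLin
              ((h : GL (Fin d) ℝ) : Matrix (Fin d) (Fin d) ℝ)ᵀ ξ) ^ 2 = 0 := by
            intro ξ
            by_contra hne
            rw [mul_eq_zero, not_or, pow_eq_zero_iff two_ne_zero, pow_eq_zero_iff two_ne_zero] at hne
            exact hK' (hφK h ξ hne.1 hne.2)
          rw [lintegral_fourier_conj_mul_dilateFun hφ hφc]
          simp [hz]
    _ < ⊤ := by
        refine (lintegral_indicator_const_le _ _).trans_lt ?_
        exact ENNReal.mul_lt_top ENNReal.ofReal_lt_top hK.measure_lt_top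

/-- If the transposed action of a closed group `H` comes from a unital commutative product on
`ℝ^d`, then the quasi-regular representation is square-integrable. -/
theorem quasiRegularSquareIntegrable_of_mul {H : Subgroup (GL (Fin d) ℝ)}
    (hH : IsClosed (H : Set (GL (Fin d) ℝ)))
    (L : EuclideanSpace ℝ (Fin d) →ₗ[ℝ] Matrix (Fin d) (Fin d) ℝ) {e : EuclideanSpace ℝ (Fin d)}
    (hone : L e = 1) (hmul : ∀ z w, L (Matrix.toEuclideanLin (L z) w) = L z * L w)
    (hHL : ∀ h ∈ H, ∃ z, (h : Matrix (Fin d) (Fin d) ℝ) = (L z)ᵀ) :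
    QuasiRegularSquareIntegrable H := by
  have hLc : Continuous L := L.continuous_of_finiteDimensional
  have hopen : IsOpen {z | (L z).det ≠ 0} := isOpen_ne.preimage hLc.matrix_det
  -- Invertibility of `L` is open and holds at the unit `e`; the outer radius `r / 2` keeps the
  -- closed support of the bump inside this region.
  obtain ⟨r, hr, hball⟩ := Metric.isOpen_iff.1 hopen e (by simp [hone])
  let φ : ContDiffBump e := ⟨r / 4, r / 2, by positivity, by linarith⟩
  have hC : ∀ ξ ∈ Metric.closedBall e (r / 2), (L ξ).det ≠ 0 := fun ξ hξ =>
    hball (Metric.closedBall_subset_ball (by linarith) hξ)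
  have hφC : ∀ ξ, φ ξ ≠ 0 → ξ ∈ Metric.closedBall e (r / 2) := fun ξ hξ =>
    Metric.ball_subset_closedBall (φ.support_eq ▸ hξ)
  let σ : Metric.closedBall e (r / 2) → GL (Fin d) ℝ := fun ξ =>
    Matrix.GeneralLinearGroup.mkOfDetNeZero (L ξ)ᵀ (by
      rw [Matrix.det_transpose]
      exact hC ξ ξ.2)
  have hσval : ∀ ξ, (σ ξ : Matrix (Fin d) (Fin d) ℝ) = (L ξ)ᵀ := fun ξ => rfl
  have hσ : Continuous σ :=
    isOpenEmbedding_coe_GL.isEmbedding.continuous_iff.2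
      (hLc.comp continuous_subtype_val).matrix_transpose
  have : CompactSpace (Metric.closedBall e (r / 2)) :=
    isCompact_iff_compactSpace.1 (isCompact_closedBall e (r / 2))
  -- If `hᵀξ = ξ'` with both points in the ball, multiplicativity of `L` gives `σ ξ' = σ ξ * h`. So
  -- `h` is a quotient of values of `σ` on a compact set.
  have hKGL : IsCompact (Set.range fun p : Metric.closedBall e (r / 2) × Metric.closedBall e (r / 2) =>
      (σ p.1)⁻¹ * σ p.2) :=
    isCompact_range (((hσ.comp continuous_fst).inv).mul (hσ.comp continuous_snd))
  refine quasiRegularSquareIntegrable_of_isCompact hH φ.contDiff φ.hasCompactSupport ?_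
    (fun ξ => ?_) (hH.isClosedEmbedding_subtypeVal.isCompact_preimage hKGL) fun h ξ h1 h2 => ?_
  · intro h0
    have := φ.one_of_mem_closedBall (Metric.mem_closedBall_self φ.rIn_pos.le)
    rw [h0] at this
    exact zero_ne_one this
  · rw [abs_of_nonneg φ.nonneg]
    exact φ.le_one
  · refine ⟨⟨⟨ξ, hφC _ h1⟩, ⟨_, hφC _ h2⟩⟩, ?_⟩
    obtain ⟨z, hz⟩ := hHL h h.2
    simp only
    rw [inv_mul_eq_iff_eq_mul]
    apply Units.ext
    rw [Units.val_mul, hσval, hσval]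
    simp only
    rw [hz, Matrix.transpose_transpose, hmul, Matrix.transpose_mul]

end Shearlet

namespace Shearlet

variable {d : ℕ} {A : Type*} [CommRing A] [Algebra ℝ A]

/-! ### Triangular bases -/

/-- A basis starting with `1` whose other members span the nilradical, and on which the
nilradical acts strictly triangularly. -/
structure IsTriangularBasis [NeZero d] (b : Module.Basis (Fin d) ℝ A) : Prop where
  zero_eq_one : b 0 = 1
  mem_nilrad_iff : ∀ x, x ∈ nilrad A ↔ b.repr x 0 = 0
  repr_mul_eq_zero : ∀ x ∈ nilrad A, ∀ j k, k ≤ j → b.repr (x * b j) k = 0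

theorem mem_nilrad {x : A} : x ∈ nilrad A ↔ IsNilpotent x := Iff.rfl

theorem mul_mem_nilrad {x : A} (hx : x ∈ nilrad A) (y : A) : x * y ∈ nilrad A :=
  (nilradical A).mul_mem_right y hx

theorem exists_basis_of_isJordanHolderBasis [NeZero d] (hd : Module.finrank ℝ A = d)
    (hA : IsIrreducibleAlgebra A) {a : Fin d → A} (ha1 : a 0 = 1) (ha : IsJordanHolderBasis a) :
    ∃ b : Module.Basis (Fin d) ℝ A, ⇑b = a := by
  have hspan : ⊤ ≤ Submodule.span ℝ (Set.range a) := by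
    rw [← hA.sup_eq_top, ← ha.span_eq]
    refine sup_le (Submodule.span_mono ?_) (Submodule.span_mono ?_)
    · rintro _ rfl
      exact ⟨0, ha1⟩
    · rintro _ ⟨i, rfl⟩
      exact ⟨i, rfl⟩
  exact ⟨basisOfTopLeSpanOfCardEqFinrank a hspan (by simp [hd]),
    coe_basisOfTopLeSpanOfCardEqFinrank _ _ _⟩

theorem mem_tailSpan_iff (b : Module.Basis (Fin d) ℝ A) {m : ℕ} {x : A} :
    x ∈ tailSpan b m ↔ ∀ k : Fin d, (k : ℕ) < m → b.repr x k = 0 := by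
  rw [tailSpan, b.mem_span_image]
  constructor
  · intro h k hk
    by_contra hne
    exact absurd (h (Finsupp.mem_support_iff.2 hne)) (not_le.2 hk)
  · intro h k hk
    by_contra hlt
    exact Finsupp.mem_support_iff.1 hk (h k (not_le.1 hlt))

theorem mem_span_basis_iff [NeZero d] (b : Module.Basis (Fin d) ℝ A) {x : A} :
    x ∈ Submodule.span ℝ (Set.range fun i : {i : Fin d // i ≠ 0} => b i) ↔ b.repr x 0 = 0 := by
  have hr : (Set.range fun i : {i : Fin d // i ≠ 0} => b i) = b '' {i | i ≠ 0} := by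
    ext y
    simp
  rw [hr, b.mem_span_image]
  constructor
  · intro h
    by_contra hne
    exact h (Finsupp.mem_support_iff.2 hne) rfl
  · rintro h k hk rfl
    exact Finsupp.mem_support_iff.1 hk h

/-- The filtration condition gives strict triangularity on every basis vector but the last. There,
nilpotency takes over: `x` can only scale the last vector, and the scalar must be nilpotent. -/
theorem IsJordanHolderBasis.isTriangularBasis [NeZero d] {b : Module.Basis (Fin d) ℝ A} (h1 : b 0 = 1)
    (hb : IsJordanHolderBasis b) : IsTriangularBasis b := by
  have hN : ∀ x, x ∈ nilrad A ↔ b.repr x 0 = 0 := fun x => by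
    rw [← hb.span_eq, mem_span_basis_iff]
  refine ⟨h1, hN, fun x hx j k hkj => ?_⟩
  rcases Nat.lt_or_ge ((j : ℕ) + 1) d with hj | hj
  · refine (mem_tailSpan_iff b).1 (hb.mul_mem j hj x hx (b j) ?_) k (Nat.lt_succ_of_le hkj)
    exact Submodule.subset_span ⟨j, le_refl (j : ℕ), rfl⟩
  · rcases Nat.eq_zero_or_pos (j : ℕ) with hj0 | hj0
    -- Here `d = 1`, and the only basis vector is `1`.
    · have hj' : j = 0 := Fin.ext hj0
      subst hj'
      have hk : k = 0 := nonpos_iff_eq_zero.1 hkj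
      rw [h1, mul_one, hk]
      exact (hN x).1 hx
    · have hlt := j.2
      -- The last instance of the filtration condition, `m = d - 2`, also contains the last vector
      -- among its inputs and puts `x * b j` on the line through `b j`.
      have hmem : x * b j ∈ tailSpan b ((j : ℕ) - 1 + 1) :=
        hb.mul_mem (j - 1) (by omega) x hx (b j)
          (Submodule.subset_span ⟨j, by simp, rfl⟩)
      have hz : ∀ k : Fin d, k < j → b.repr (x * b j) k = 0 := fun k hk =>
        (mem_tailSpan_iff b).1 hmem k (by have : (k : ℕ) < j := hk; omega)
      have hxj : x * b j = b.repr (x * b j) j • b j := by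
        conv_lhs => rw [← b.sum_repr (x * b j)]
        refine Finset.sum_eq_single j (fun k _ hk => ?_) (by simp)
        have hkj : k < j := by
          refine lt_of_le_of_ne ?_ hk
          have := k.2
          exact Fin.le_def.2 (by omega)
        rw [hz k hkj, zero_smul]
      obtain ⟨n, hn⟩ := mem_nilrad.1 hx
      have hpow : ∀ n : ℕ, x ^ n * b j = b.repr (x * b j) j ^ n • b j := by
        intro n
        induction n with
        | zero => simp
        | succ n ih => rw [pow_succ, mul_assoc, hxj, mul_smul_comm, ih, smul_smul, pow_succ']; simp
      have h0 := hpow n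
      rw [hn, zero_mul, eq_comm, smul_eq_zero, or_iff_left (b.ne_zero j)] at h0
      rcases hkj.lt_or_eq with hlt | rfl
      · exact hz k hlt
      · exact eq_zero_of_pow_eq_zero h0

namespace IsTriangularBasis

variable [NeZero d] {b : Module.Basis (Fin d) ℝ A} (hb : IsTriangularBasis b)
include hb

/-- By commutativity either factor can play the nilpotent multiplier, so strict triangularity
applies to the larger of the two indices. -/
theorem repr_mul_basis_eq_zero {i j k : Fin d} (hi : i ≠ 0) (hj : j ≠ 0) (hk : k ≤ max i j) :
    b.repr (b i * b j) k = 0 := by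
  have hN : ∀ i : Fin d, i ≠ 0 → b i ∈ nilrad A := fun i hi => by
    rw [hb.mem_nilrad_iff, b.repr_self, Finsupp.single_eq_of_ne hi.symm]
  rcases le_max_iff.1 hk with h | h
  · rw [mul_comm]
    exact hb.repr_mul_eq_zero _ (hN j hj) _ _ h
  · exact hb.repr_mul_eq_zero _ (hN i hi) _ _ h

theorem sub_smul_one_mem_nilrad (x : A) : x - b.repr x 0 • (1 : A) ∈ nilrad A := by
  rw [hb.mem_nilrad_iff, map_sub, map_smul, ← hb.zero_eq_one]
  simp

theorem isUnit_of_repr_ne_zero {x : A} (hx : b.repr x 0 ≠ 0) : IsUnit x := by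
  have h1 : IsUnit (b.repr x 0 • (1 : A)) := by
    rw [← Algebra.algebraMap_eq_smul_one]
    exact hx.isUnit.map _
  have h2 := (mem_nilrad.1 (hb.sub_smul_one_mem_nilrad x)).isUnit_add_left_of_commute h1
    (Commute.all _ _)
  rwa [add_sub_cancel] at h2

end IsTriangularBasis

/-! ### The transposed regular representation -/

/-- The transposed regular representation `x ↦ Ψ(x)ᵀ` in the basis `b`. -/
noncomputable def transposedRep (b : Module.Basis (Fin d) ℝ A) :
    A →ₐ[ℝ] Matrix (Fin d) (Fin d) ℝ :=
  AlgHom.ofLinearMap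
    ((Matrix.transposeLinearEquiv (Fin d) (Fin d) ℝ ℝ).toLinearMap ∘ₗ
      (Algebra.leftMulMatrix b).toLinearMap)
    (by simp)
    -- Transposition reverses products; commutativity of `A` restores the order.
    (fun x y => by simp [mul_comm x y])

theorem transposedRep_eq (b : Module.Basis (Fin d) ℝ A) (x : A) :
    transposedRep b x = (Algebra.leftMulMatrix b x)ᵀ := rfl

theorem transposedRep_apply (b : Module.Basis (Fin d) ℝ A) (x : A) (j k : Fin d) :
    transposedRep b x j k = b.repr (x * b j) k := by
  rw [transposedRep_eq, Matrix.transpose_apply, Algebra.leftMulMatrix_eq_repr_mul]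

theorem transposedRep_injective (b : Module.Basis (Fin d) ℝ A) :
    Function.Injective (transposedRep b) :=
  Matrix.transpose_injective.comp (Algebra.leftMulMatrix_injective b)

/-- The image of the nilradical under the transposed regular representation. -/
noncomputable def shearAlgebra (b : Module.Basis (Fin d) ℝ A) :
    Submodule ℝ (Matrix (Fin d) (Fin d) ℝ) :=
  (nilrad A).map (transposedRep b).toLinearMap

theorem mem_shearAlgebra {b : Module.Basis (Fin d) ℝ A} {M : Matrix (Fin d) (Fin d) ℝ} :
    M ∈ shearAlgebra b ↔ ∃ x ∈ nilrad A, M = transposedRep b x :=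
  ⟨fun ⟨x, hx, h⟩ => ⟨x, hx, h.symm⟩, fun ⟨x, hx, h⟩ => ⟨x, hx, h.symm⟩⟩

theorem isClosed_shearAlgebra (b : Module.Basis (Fin d) ℝ A) :
    IsClosed (shearAlgebra b : Set (Matrix (Fin d) (Fin d) ℝ)) :=
  Submodule.closed_of_finiteDimensional _

theorem mul_mem_shearAlgebra {b : Module.Basis (Fin d) ℝ A} {M N : Matrix (Fin d) (Fin d) ℝ}
    (hM : M ∈ shearAlgebra b) (hN : N ∈ shearAlgebra b) : M * N ∈ shearAlgebra b := by
  obtain ⟨x, hx, rfl⟩ := mem_shearAlgebra.1 hM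
  obtain ⟨y, hy, rfl⟩ := mem_shearAlgebra.1 hN
  exact mem_shearAlgebra.2 ⟨x * y, mul_mem_nilrad hx y, (map_mul _ _ _).symm⟩

/-- The group of all `I + Ψ(x)ᵀ` with `x` nilpotent. -/
noncomputable def shearGroup (b : Module.Basis (Fin d) ℝ A) : Subgroup (GL (Fin d) ℝ) where
  carrier := {g | (g : Matrix (Fin d) (Fin d) ℝ) - 1 ∈ shearAlgebra b}
  mul_mem' {g h} hg hh := by
    have e : ((g * h : GL (Fin d) ℝ) : Matrix (Fin d) (Fin d) ℝ) - 1 =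
        ((g : Matrix (Fin d) (Fin d) ℝ) - 1) * ((h : Matrix (Fin d) (Fin d) ℝ) - 1) +
        ((g : Matrix (Fin d) (Fin d) ℝ) - 1) + ((h : Matrix (Fin d) (Fin d) ℝ) - 1) := by
      rw [Units.val_mul]
      noncomm_ring
    rw [Set.mem_ofPred_eq, e]
    exact add_mem (add_mem (mul_mem_shearAlgebra hg hh) hg) hh
  one_mem' := by simp
  inv_mem' {g} hg := by
    obtain ⟨x, hx, hgx⟩ := mem_shearAlgebra.1 hg
    obtain ⟨u, hu⟩ := (mem_nilrad.1 hx).isUnit_one_add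
    have hgu : g = Units.map (transposedRep b : A →* Matrix (Fin d) (Fin d) ℝ) u := by
      apply Units.ext
      rw [Units.coe_map, hu, ← sub_add_cancel (g : Matrix (Fin d) (Fin d) ℝ) 1, hgx]
      simp [add_comm]
    -- With `u = 1 + x`, the witness is `u⁻¹ - 1 = -x u⁻¹`, nilpotent because the nilradical is an
    -- ideal.
    refine mem_shearAlgebra.2 ⟨-(x * ↑u⁻¹), neg_mem (mul_mem_nilrad hx _), ?_⟩
    have hxu : -(x * ↑u⁻¹) = ((u⁻¹ : Aˣ) : A) - 1 := by
      have h2 : x = u - 1 := by rw [hu]; ring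
      rw [h2, sub_mul, Units.mul_inv]
      ring
    rw [hgu, ← map_inv, Units.coe_map, hxu, map_sub, map_one]
    rfl

theorem mem_shearGroup {b : Module.Basis (Fin d) ℝ A} {g : GL (Fin d) ℝ} :
    g ∈ shearGroup b ↔ (g : Matrix (Fin d) (Fin d) ℝ) - 1 ∈ shearAlgebra b := Iff.rfl

/-! ### The dilation group and its scaling subgroup. -/

/-- The group of all invertible `Ψ(x)ᵀ`. -/
noncomputable def dilationGroup (b : Module.Basis (Fin d) ℝ A) : Subgroup (GL (Fin d) ℝ) :=
  (Units.map (transposedRep b : A →* Matrix (Fin d) (Fin d) ℝ)).range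

theorem exists_of_mem_dilationGroup {b : Module.Basis (Fin d) ℝ A} {g : GL (Fin d) ℝ}
    (hg : g ∈ dilationGroup b) : ∃ x, (g : Matrix (Fin d) (Fin d) ℝ) = transposedRep b x := by
  obtain ⟨u, rfl⟩ := hg
  exact ⟨u, rfl⟩

/-- The group of positive multiples of the identity. -/
noncomputable def positiveScalars (d : ℕ) : Subgroup (GL (Fin d) ℝ) where
  carrier := {g | ∃ t : ℝ, 0 < t ∧ (g : Matrix (Fin d) (Fin d) ℝ) = t • 1}
  mul_mem' := by
    rintro g h ⟨t, ht, hg⟩ ⟨s, hs, hh⟩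
    exact ⟨t * s, mul_pos ht hs, by rw [Units.val_mul, hg, hh, smul_mul_smul_comm, one_mul]⟩
  one_mem' := ⟨1, one_pos, by simp⟩
  inv_mem' := by
    rintro g ⟨t, ht, hg⟩
    refine ⟨t⁻¹, inv_pos.2 ht, ?_⟩
    rw [← mul_one ((g⁻¹ : GL (Fin d) ℝ) : Matrix (Fin d) (Fin d) ℝ), Units.inv_mul_eq_iff_eq_mul,
      hg, smul_mul_smul_comm, mul_inv_cancel₀ ht.ne', one_mul, one_smul]

theorem mem_positiveScalars {g : GL (Fin d) ℝ} : g ∈ positiveScalars d ↔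
    ∃ t : ℝ, 0 < t ∧ (g : Matrix (Fin d) (Fin d) ℝ) = t • 1 := Iff.rfl

theorem mem_positiveScalars_iff_exp {g : GL (Fin d) ℝ} : g ∈ positiveScalars d ↔
    ∃ r : ℝ, (g : Matrix (Fin d) (Fin d) ℝ) =
      NormedSpace.exp (r • Matrix.diagonal fun _ : Fin d => (1 : ℝ)) := by
  have hexp : ∀ r : ℝ, NormedSpace.exp (r • Matrix.diagonal fun _ : Fin d => (1 : ℝ)) =
      Real.exp r • (1 : Matrix (Fin d) (Fin d) ℝ) := by
    intro r
    rw [← Matrix.diagonal_smul, Matrix.exp_diagonal, ← Matrix.diagonal_one, ← Matrix.diagonal_smul]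
    congr 1
    ext i
    simp [Pi.coe_exp, Real.exp_eq_exp_ℝ]
  simp only [hexp]
  exact ⟨fun ⟨t, ht, h⟩ => ⟨Real.log t, by rw [Real.exp_log ht, h]⟩,
    fun ⟨r, h⟩ => ⟨Real.exp r, Real.exp_pos r, h⟩⟩

theorem isClosed_positiveScalars [NeZero d] :
    IsClosed (positiveScalars d : Set (GL (Fin d) ℝ)) := by
  -- The weak inequality makes the condition closed; the scalar `0` is excluded by invertibility.
  have hset : (positiveScalars d : Set (GL (Fin d) ℝ)) =
      (fun g : GL (Fin d) ℝ => (g : Matrix (Fin d) (Fin d) ℝ)) ⁻¹'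
        {M | M = M 0 0 • (1 : Matrix (Fin d) (Fin d) ℝ) ∧ 0 ≤ M 0 0} := by
    ext g
    rw [SetLike.mem_coe, mem_positiveScalars, Set.mem_preimage]
    constructor
    · rintro ⟨t, ht, hg⟩
      rw [hg]
      simp [ht.le]
    · rintro ⟨h1, h2⟩
      refine ⟨_, lt_of_le_of_ne h2 fun h0 => ?_, h1⟩
      rw [← h0, zero_smul] at h1
      exact g.ne_zero h1
  rw [hset]
  have hc : Continuous fun M : Matrix (Fin d) (Fin d) ℝ => M 0 0 := continuous_id.matrix_elem 0 0
  exact ((isClosed_eq continuous_id (hc.smul continuous_const)).inter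
    (isClosed_le continuous_const hc)).preimage Units.continuous_val

/-! ### Topology and commutativity of the shearing group. -/

theorem isClosed_shearGroup (b : Module.Basis (Fin d) ℝ A) :
    IsClosed (shearGroup b : Set (GL (Fin d) ℝ)) :=
  (isClosed_shearAlgebra b).preimage (Units.continuous_val.sub continuous_const)

theorem isUnit_one_add_of_mem_shearAlgebra {b : Module.Basis (Fin d) ℝ A}
    {M : Matrix (Fin d) (Fin d) ℝ} (hM : M ∈ shearAlgebra b) : IsUnit (1 + M) := by
  obtain ⟨x, hx, rfl⟩ := mem_shearAlgebra.1 hM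
  have := (mem_nilrad.1 hx).isUnit_one_add.map (transposedRep b)
  rwa [map_add, map_one] at this

/-- Invertibility is automatic for identity plus nilpotent, so the group is a full affine subspace
of the matrices. Its connectedness follows from convexity. -/
theorem coe_image_shearGroup (b : Module.Basis (Fin d) ℝ A) :
    (fun g : GL (Fin d) ℝ => (g : Matrix (Fin d) (Fin d) ℝ)) ''
      (shearGroup b : Set (GL (Fin d) ℝ)) = (fun M => 1 + M) '' (shearAlgebra b : Set _) := by
  ext M
  constructor
  · rintro ⟨g, hg, rfl⟩
    exact ⟨_, hg, add_sub_cancel _ _⟩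
  · rintro ⟨M, hM, rfl⟩
    obtain ⟨g, hg⟩ := isUnit_one_add_of_mem_shearAlgebra hM
    refine ⟨g, ?_, hg⟩
    rw [SetLike.mem_coe, mem_shearGroup, hg, add_sub_cancel_left]
    exact hM

theorem isConnected_shearGroup (b : Module.Basis (Fin d) ℝ A) :
    IsConnected (shearGroup b : Set (GL (Fin d) ℝ)) := by
  refine ⟨⟨1, one_mem _⟩, ?_⟩
  rw [← isOpenEmbedding_coe_GL.isInducing.isPreconnected_image, coe_image_shearGroup]
  exact (shearAlgebra b).convex.isPreconnected.image _ (continuous_const.add continuous_id).continuousOn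

theorem comm_shearGroup {b : Module.Basis (Fin d) ℝ A} {g h : GL (Fin d) ℝ}
    (hg : g ∈ shearGroup b) (hh : h ∈ shearGroup b) : g * h = h * g := by
  obtain ⟨x, -, hx⟩ := mem_shearAlgebra.1 hg
  obtain ⟨y, -, hy⟩ := mem_shearAlgebra.1 hh
  apply Units.ext
  rw [Units.val_mul, Units.val_mul, sub_eq_iff_eq_add.1 hx, sub_eq_iff_eq_add.1 hy,
    ← map_one (transposedRep b), ← map_add, ← map_add, ← map_mul, ← map_mul, mul_comm]

/-! ### The Lie algebra of the shearing group -/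

section Exponential

attribute [local instance] Matrix.linftyOpNormedRing Matrix.linftyOpNormedAlgebra

/-- All terms of the exponential series after the constant one lie in the subspace, which is stable
under products and closed. -/
theorem exp_sub_one_mem_shearAlgebra {b : Module.Basis (Fin d) ℝ A}
    {M : Matrix (Fin d) (Fin d) ℝ} (hM : M ∈ shearAlgebra b) :
    NormedSpace.exp M - 1 ∈ shearAlgebra b := by
  have hs : HasSum (fun n : ℕ => ((n.factorial : ℝ)⁻¹) • M ^ n) (NormedSpace.exp M) :=
    NormedSpace.exp_series_hasSum_exp' (𝕂 := ℝ) M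
  have hs' := (hasSum_nat_add_iff' 1).2 hs
  simp only [Finset.range_one, Finset.sum_singleton, Nat.factorial_zero, Nat.cast_one, inv_one,
    pow_zero, one_smul] at hs'
  have hpow : ∀ n : ℕ, M ^ (n + 1) ∈ shearAlgebra b := by
    intro n
    induction n with
    | zero => simpa using hM
    | succ n ih => exact pow_succ M (n + 1) ▸ mul_mem_shearAlgebra ih hM
  exact (isClosed_shearAlgebra b).mem_of_tendsto hs' (Filter.Eventually.of_forall fun s =>
    Submodule.sum_mem _ fun n _ => Submodule.smul_mem _ _ (hpow n))

/-- The difference quotients of `r ↦ exp (r • M)` at `0` lie in `V` and converge to `M`. -/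
theorem mem_of_forall_exp_smul_sub_one_mem {V : Submodule ℝ (Matrix (Fin d) (Fin d) ℝ)}
    (hV : IsClosed (V : Set (Matrix (Fin d) (Fin d) ℝ))) {M : Matrix (Fin d) (Fin d) ℝ}
    (h : ∀ r : ℝ, NormedSpace.exp (r • M) - 1 ∈ V) : M ∈ V := by
  have hd : HasDerivAt (fun r : ℝ => NormedSpace.exp (r • M)) M 0 := by
    have h0 := hasDerivAt_exp_smul_const (𝕂 := ℝ) M (0 : ℝ)
    rw [zero_smul, NormedSpace.exp_zero, one_mul] at h0
    exact h0
  have ht := hasDerivAt_iff_tendsto_slope_zero.1 hd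
  refine hV.mem_of_tendsto ht (Filter.Eventually.of_forall fun r => V.smul_mem _ ?_)
  simpa using h r

end Exponential

theorem lieAlgebra_shearGroup (b : Module.Basis (Fin d) ℝ A) :
    lieAlgebra (shearGroup b) = (shearAlgebra b : Set (Matrix (Fin d) (Fin d) ℝ)) := by
  ext M
  constructor
  · intro h
    refine mem_of_forall_exp_smul_sub_one_mem (isClosed_shearAlgebra b) fun r => ?_
    obtain ⟨g, hg, he⟩ := h r
    rw [← he]
    exact hg
  · intro hM r
    obtain ⟨g, hg⟩ := Matrix.isUnit_exp (r • M)
    refine ⟨g, ?_, hg⟩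
    rw [mem_shearGroup, hg]
    exact exp_sub_one_mem_shearAlgebra ((shearAlgebra b).smul_mem r hM)

end Shearlet

namespace Shearlet

variable {d : ℕ} {A : Type*} [CommRing A] [Algebra ℝ A]

/-! ### The dilation group of an irreducible algebra -/

theorem mem_dilationGroup_of_isUnit {b : Module.Basis (Fin d) ℝ A} {g : GL (Fin d) ℝ} {x : A}
    (hx : IsUnit x) (hg : (g : Matrix (Fin d) (Fin d) ℝ) = transposedRep b x) :
    g ∈ dilationGroup b := by
  obtain ⟨u, rfl⟩ := hx
  exact ⟨u, Units.ext hg.symm⟩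

theorem shearGroup_le_dilationGroup (b : Module.Basis (Fin d) ℝ A) :
    shearGroup b ≤ dilationGroup b := by
  intro g hg
  obtain ⟨x, hx, hgx⟩ := mem_shearAlgebra.1 hg
  refine mem_dilationGroup_of_isUnit (mem_nilrad.1 hx).isUnit_one_add ?_
  rw [map_add, map_one, ← hgx, add_sub_cancel]

theorem positiveScalars_le_dilationGroup (b : Module.Basis (Fin d) ℝ A) :
    positiveScalars d ≤ dilationGroup b := by
  rintro g ⟨t, ht, hg⟩
  refine mem_dilationGroup_of_isUnit (x := algebraMap ℝ A t) (ht.ne'.isUnit.map _) ?_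
  rw [hg, AlgHom.commutes, Algebra.algebraMap_eq_smul_one]

/-! ### The product of `A` carried to `ℝ^d`, and admissibility. -/

/-- Left multiplication of `A` in coordinates, as matrices acting on `ℝ^d`. -/
noncomputable def coordMul (b : Module.Basis (Fin d) ℝ A) :
    EuclideanSpace ℝ (Fin d) →ₗ[ℝ] Matrix (Fin d) (Fin d) ℝ :=
  (Algebra.leftMulMatrix b).toLinearMap ∘ₗ b.equivFun.symm.toLinearMap ∘ₗ
    (WithLp.linearEquiv 2 ℝ (Fin d → ℝ)).toLinearMap

theorem coordMul_apply (b : Module.Basis (Fin d) ℝ A) (z : EuclideanSpace ℝ (Fin d)) :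
    coordMul b z = Algebra.leftMulMatrix b (b.equivFun.symm z.ofLp) := rfl

theorem leftMulMatrix_mulVec (b : Module.Basis (Fin d) ℝ A) (x : A) (v : Fin d → ℝ) :
    Algebra.leftMulMatrix b x *ᵥ v = b.equivFun (x * b.equivFun.symm v) := by
  have := Algebra.leftMulMatrix_mulVec_repr b x (b.equivFun.symm v)
  rwa [← b.equivFun_apply, ← b.equivFun_apply, b.equivFun.apply_symm_apply] at this

theorem equivFun_basis (b : Module.Basis (Fin d) ℝ A) (i : Fin d) :
    b.equivFun (b i) = Pi.single i 1 := by
  ext j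
  rw [b.equivFun_self]
  simp [Pi.single_apply, eq_comm]

theorem toEuclideanLin_coordMul (b : Module.Basis (Fin d) ℝ A)
    (z w : EuclideanSpace ℝ (Fin d)) :
    Matrix.toEuclideanLin (coordMul b z) w =
      WithLp.toLp 2 (b.equivFun (b.equivFun.symm z.ofLp * b.equivFun.symm w.ofLp)) := by
  rw [Matrix.toLpLin_apply, coordMul_apply, leftMulMatrix_mulVec]

theorem toEuclideanLin_coordMul_comm (b : Module.Basis (Fin d) ℝ A)
    (z w : EuclideanSpace ℝ (Fin d)) :
    Matrix.toEuclideanLin (coordMul b z) w = Matrix.toEuclideanLin (coordMul b w) z := by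
  rw [toEuclideanLin_coordMul, toEuclideanLin_coordMul, mul_comm]

theorem coordMul_toEuclideanLin (b : Module.Basis (Fin d) ℝ A)
    (z w : EuclideanSpace ℝ (Fin d)) :
    coordMul b (Matrix.toEuclideanLin (coordMul b z) w) = coordMul b z * coordMul b w := by
  rw [toEuclideanLin_coordMul, coordMul_apply, coordMul_apply, coordMul_apply,
    LinearEquiv.symm_apply_apply, map_mul]

theorem coordMul_one (b : Module.Basis (Fin d) ℝ A) :
    coordMul b (WithLp.toLp 2 (b.equivFun 1)) = 1 := by
  rw [coordMul_apply, LinearEquiv.symm_apply_apply, map_one]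

theorem coordMul_equivFun (b : Module.Basis (Fin d) ℝ A) (x : A) :
    coordMul b (WithLp.toLp 2 (b.equivFun x)) = Algebra.leftMulMatrix b x := by
  rw [coordMul_apply, LinearEquiv.symm_apply_apply]

namespace IsTriangularBasis

variable [NeZero d] {b : Module.Basis (Fin d) ℝ A} (hb : IsTriangularBasis b)
include hb

/-- An element with zero scalar part is nilpotent, and so is its matrix, which then cannot be
invertible. -/
theorem isUnit_of_eq_transposedRep {g : GL (Fin d) ℝ} {x : A}
    (hg : (g : Matrix (Fin d) (Fin d) ℝ) = transposedRep b x) : IsUnit x := by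
  refine hb.isUnit_of_repr_ne_zero fun h0 => ?_
  have hnil := (mem_nilrad.1 ((hb.mem_nilrad_iff x).2 h0)).map (transposedRep b)
  rw [← hg] at hnil
  exact hnil.not_isUnit g.isUnit

/-- The group is the trace on `GL` of a linear subspace of matrices: an invertible matrix in the
image of `A` comes from a unit. -/
theorem isClosed_dilationGroup : IsClosed (dilationGroup b : Set (GL (Fin d) ℝ)) := by
  have hset : (dilationGroup b : Set (GL (Fin d) ℝ)) =
      (fun g : GL (Fin d) ℝ => (g : Matrix (Fin d) (Fin d) ℝ)) ⁻¹'
        (LinearMap.range (transposedRep b).toLinearMap : Set (Matrix (Fin d) (Fin d) ℝ)) := by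
    ext g
    constructor
    · intro hg
      obtain ⟨x, hx⟩ := exists_of_mem_dilationGroup hg
      exact ⟨x, hx.symm⟩
    · rintro ⟨x, hx⟩
      exact mem_dilationGroup_of_isUnit (hb.isUnit_of_eq_transposedRep hx.symm) hx.symm
  rw [hset]
  exact (Submodule.closed_of_finiteDimensional _).preimage Units.continuous_val

/-- Non-units have zero scalar part, hence lie in a coordinate hyperplane, which is null. -/
theorem ae_det_coordMul_ne_zero : ∀ᵐ z, (coordMul b z).det ≠ 0 := by
  let V : Submodule ℝ (EuclideanSpace ℝ (Fin d)) :=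
    LinearMap.ker (EuclideanSpace.proj (𝕜 := ℝ) (0 : Fin d)).toLinearMap
  have hV : V ≠ ⊤ := fun h => by
    have h1 : EuclideanSpace.single (0 : Fin d) (1 : ℝ) ∈ V := h ▸ Submodule.mem_top
    simp [V] at h1
  refine measure_mono_null (fun z hz => ?_) (Measure.addHaar_submodule volume V hV)
  by_contra hzV
  apply hz
  have hu : IsUnit (b.equivFun.symm z.ofLp) := hb.isUnit_of_repr_ne_zero (by
    rw [← b.equivFun_apply, b.equivFun.apply_symm_apply]
    exact fun h0 => hzV h0)
  change (coordMul b z).det ≠ 0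
  rw [coordMul_apply]
  exact ((Matrix.isUnit_iff_isUnit_det _).1 (hu.map (Algebra.leftMulMatrix b))).ne_zero

theorem isIrreduciblyAdmissible_dilationGroup : IsIrreduciblyAdmissible (dilationGroup b) where
  isClosed := hb.isClosed_dilationGroup
  irreducible := quasiRegularIrreducible_of_mul (coordMul b) (toEuclideanLin_coordMul_comm b)
    hb.ae_det_coordMul_ne_zero fun z hz => by
      have hz' : (coordMul b z)ᵀ.det ≠ 0 := by rwa [Matrix.det_transpose]
      refine ⟨Matrix.GeneralLinearGroup.mkOfDetNeZero _ hz', ?_, rfl⟩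
      have he : ((Matrix.GeneralLinearGroup.mkOfDetNeZero _ hz' : GL (Fin d) ℝ) :
        Matrix (Fin d) (Fin d) ℝ) = transposedRep b (b.equivFun.symm z.ofLp) := rfl
      exact mem_dilationGroup_of_isUnit (hb.isUnit_of_eq_transposedRep he) he
  squareIntegrable := quasiRegularSquareIntegrable_of_mul hb.isClosed_dilationGroup (coordMul b)
    (coordMul_one b) (coordMul_toEuclideanLin b) fun h hh => by
      obtain ⟨x, hx⟩ := exists_of_mem_dilationGroup hh
      exact ⟨_, by rw [hx, coordMul_equivFun, transposedRep_eq]⟩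

/-! ### Unipotence and the factorization `± δ s`. -/

theorem isUnipotent_of_mem_shearGroup {g : GL (Fin d) ℝ} (hg : g ∈ shearGroup b) :
    IsUnipotent g := by
  obtain ⟨x, hx, hgx⟩ := mem_shearAlgebra.1 hg
  have hval : ∀ j k, k ≤ j → (g : Matrix (Fin d) (Fin d) ℝ) j k =
      (1 : Matrix (Fin d) (Fin d) ℝ) j k := by
    intro j k hkj
    rw [sub_eq_iff_eq_add.1 hgx, Matrix.add_apply, transposedRep_apply,
      hb.repr_mul_eq_zero x hx j k hkj, zero_add]
  exact ⟨fun i j hij => by rw [hval i j hij.le, Matrix.one_apply_ne hij.ne'],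
    fun i => by rw [hval i i le_rfl, Matrix.one_apply_eq]⟩

/-- The top left entry of `± t s` is `± t`, because `s` is unipotent. It determines the sign and `t
> 0`, and then `s`. -/
theorem eq_of_smul_mul_eq {ε ε' : ℤˣ} {δ δ' s s' : GL (Fin d) ℝ}
    (hδ : δ ∈ positiveScalars d) (hδ' : δ' ∈ positiveScalars d)
    (hs : s ∈ shearGroup b) (hs' : s' ∈ shearGroup b)
    (h : ((ε : ℤ) : ℝ) • ((δ : Matrix (Fin d) (Fin d) ℝ) * (s : Matrix (Fin d) (Fin d) ℝ)) =
      ((ε' : ℤ) : ℝ) • ((δ' : Matrix (Fin d) (Fin d) ℝ) * (s' : Matrix (Fin d) (Fin d) ℝ))) :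
    ε = ε' ∧ δ = δ' ∧ s = s' := by
  obtain ⟨t, ht, hδt⟩ := hδ
  obtain ⟨t', ht', hδt'⟩ := hδ'
  rw [hδt, hδt', smul_mul_assoc, smul_mul_assoc, one_mul, one_mul, smul_smul, smul_smul] at h
  have h00 := congrFun (congrFun h 0) 0
  rw [Matrix.smul_apply, Matrix.smul_apply, (hb.isUnipotent_of_mem_shearGroup hs).2,
    (hb.isUnipotent_of_mem_shearGroup hs').2] at h00
  have hε : ε = ε' ∧ t = t' := by
    rcases Int.units_eq_one_or ε with rfl | rfl <;> rcases Int.units_eq_one_or ε' with rfl | rfl <;>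
      simp at h00
    · exact ⟨rfl, h00⟩
    · linarith
    · linarith
    · exact ⟨rfl, h00⟩
  obtain ⟨rfl, rfl⟩ := hε
  have hne : ((ε : ℤ) : ℝ) * t ≠ 0 :=
    mul_ne_zero (Int.cast_ne_zero.2 ε.ne_zero) ht.ne'
  exact ⟨rfl, Units.ext (hδt.trans hδt'.symm), Units.ext (smul_right_injective _ hne h)⟩

/-- Write `x = t (1 + t⁻¹(x - t))` with `t ≠ 0` the scalar part of `x`; then `δ` is `|t|` times the
identity and the sign is that of `t`. -/
theorem exists_factor {h : GL (Fin d) ℝ} (hh : h ∈ dilationGroup b) :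
    ∃ ε : ℤˣ, ∃ δ ∈ positiveScalars d, ∃ s ∈ shearGroup b, (h : Matrix (Fin d) (Fin d) ℝ) =
      ((ε : ℤ) : ℝ) • ((δ : Matrix (Fin d) (Fin d) ℝ) * (s : Matrix (Fin d) (Fin d) ℝ)) := by
  obtain ⟨x, hx⟩ := exists_of_mem_dilationGroup hh
  set t := b.repr x 0 with ht
  have ht0 : t ≠ 0 := fun h0 => by
    have hnil := (mem_nilrad.1 ((hb.mem_nilrad_iff x).2 h0))
    have : Nontrivial A := ⟨b 0, 0, b.ne_zero 0⟩
    exact hnil.not_isUnit (hb.isUnit_of_eq_transposedRep hx)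
  have hy : t⁻¹ • (x - t • (1 : A)) ∈ nilrad A :=
    Submodule.smul_mem _ _ (hb.sub_smul_one_mem_nilrad x)
  have hM : transposedRep b (t⁻¹ • (x - t • (1 : A))) ∈ shearAlgebra b :=
    mem_shearAlgebra.2 ⟨_, hy, rfl⟩
  obtain ⟨s, hs⟩ := isUnit_one_add_of_mem_shearAlgebra hM
  have hx1 : t • (s : Matrix (Fin d) (Fin d) ℝ) = h := by
    rw [hs, hx, map_smul, map_sub, map_smul, map_one, smul_add, smul_smul, mul_inv_cancel₀ ht0,
      one_smul, add_sub_cancel]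
  have hpos : 0 < |t| := abs_pos.2 ht0
  have hu : IsUnit (|t| • (1 : Matrix (Fin d) (Fin d) ℝ)) := by
    rw [← Algebra.algebraMap_eq_smul_one]
    exact hpos.ne'.isUnit.map _
  obtain ⟨δ, hδ⟩ := hu
  have hsS : s ∈ shearGroup b := by
    rw [mem_shearGroup, hs, add_sub_cancel_left]
    exact hM
  rcases lt_or_gt_of_ne ht0 with hlt | hgt
  · refine ⟨-1, δ, ⟨_, hpos, hδ⟩, s, hsS, ?_⟩
    rw [hδ, ← hx1, abs_of_neg hlt]
    simp
  · refine ⟨1, δ, ⟨_, hpos, hδ⟩, s, hsS, ?_⟩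
    rw [hδ, ← hx1, abs_of_pos hgt]
    simp

theorem isShearingSubgroup : IsShearingSubgroup (shearGroup b) :=
  ⟨dilationGroup b, positiveScalars d,
    { admissible := hb.isIrreduciblyAdmissible_dilationGroup
      shear_le := shearGroup_le_dilationGroup b
      scale_le := positiveScalars_le_dilationGroup b
      isClosed_shear := isClosed_shearGroup b
      isClosed_scale := isClosed_positiveScalars
      isConnected_shear := isConnected_shearGroup b
      comm_shear := fun _ hg _ hh => comm_shearGroup hg hh
      unipotent_shear := fun _ hg => hb.isUnipotent_of_mem_shearGroup hg
      scale_eq := ⟨fun _ => 1, fun _ => mem_positiveScalars_iff_exp⟩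
      existsUnique_factor := fun h hh => by
        obtain ⟨ε, δ, hδ, s, hs, he⟩ := hb.exists_factor hh
        refine ⟨(ε, δ, s), ⟨hδ, hs, he⟩, ?_⟩
        rintro ⟨ε', δ', s'⟩ ⟨hδ', hs', he'⟩
        obtain ⟨rfl, rfl, rfl⟩ := hb.eq_of_smul_mul_eq hδ' hδ hs' hs (he'.symm.trans he)
        rfl }⟩

/-! ### Canonical basis and structure constants. -/

theorem leftMulMatrix_mulVec_single_zero (x : A) :
    Algebra.leftMulMatrix b x *ᵥ Pi.single 0 1 = b.equivFun x := by
  have h : b.equivFun.symm (Pi.single 0 1) = 1 := by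
    rw [← hb.zero_eq_one, LinearEquiv.symm_apply_eq, equivFun_basis]
  rw [leftMulMatrix_mulVec, h, mul_one]

theorem span_basis_eq_nilrad :
    Submodule.span ℝ (Set.range fun i : {i : Fin d // i ≠ 0} => b i) = nilrad A := by
  ext x
  rw [mem_span_basis_iff, hb.mem_nilrad_iff]

theorem isCanonicalBasis : IsCanonicalBasis (shearAlgebra b : Set (Matrix (Fin d) (Fin d) ℝ))
    fun i => (Algebra.leftMulMatrix b (b i))ᵀ := by
  have hli : LinearIndependent ℝ fun i : {i : Fin d // i ≠ 0} => b i :=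
    b.linearIndependent.comp _ Subtype.val_injective
  refine ⟨⟨?_, ?_, ?_⟩, ?_⟩
  · exact hli.map' (transposedRep b).toLinearMap
      (LinearMap.ker_eq_bot.2 (transposedRep_injective b))
  · have hr : Set.range (fun i : {i : Fin d // i ≠ 0} => (Algebra.leftMulMatrix b (b i))ᵀ) =
        (transposedRep b).toLinearMap '' Set.range fun i : {i : Fin d // i ≠ 0} => b i := by
      rw [← Set.range_comp]
      rfl
    rw [hr, Submodule.span_image, hb.span_basis_eq_nilrad]
    rfl
  · intro i
    rw [Matrix.transpose_transpose, hb.leftMulMatrix_mulVec_single_zero, equivFun_basis]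
  · intro X hX
    ext1 i
    have hmem : X i ∈ (shearAlgebra b : Set (Matrix (Fin d) (Fin d) ℝ)) :=
      hX.span_eq ▸ Submodule.subset_span ⟨i, rfl⟩
    obtain ⟨x, -, hx⟩ := mem_shearAlgebra.1 hmem
    -- The image of `e₁` is the coordinate vector of `x`, so the normalization leaves only `x = b
    -- i`.
    have h1 := hX.transpose_mulVec i
    rw [hx, transposedRep_eq, Matrix.transpose_transpose, hb.leftMulMatrix_mulVec_single_zero] at h1
    have hxi : x = b i := by
      apply b.equivFun.injective
      rw [h1, equivFun_basis]
    rw [hx, hxi, transposedRep_eq]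

theorem repr_one_mul (j k : Fin d) : b.repr (b 0 * b j) k = if j = k then 1 else 0 := by
  rw [hb.zero_eq_one, one_mul, b.repr_self, Finsupp.single_apply]

theorem transpose_leftMulMatrix_eq_sum {i : Fin d} (hi : i ≠ 0) :
    (Algebra.leftMulMatrix b (b i))ᵀ = Matrix.single 0 i 1 +
      ∑ j ∈ Finset.univ.filter (fun j : Fin d => j ≠ 0),
        ∑ k ∈ Finset.univ.filter (fun k : Fin d => j < k),
          Matrix.single j k (b.repr (b i * b j) k) := by
  ext p q
  rw [← transposedRep_eq, transposedRep_apply, Matrix.add_apply, Matrix.sum_apply]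
  simp only [Matrix.sum_apply, Matrix.single_apply, Finset.sum_filter]
  by_cases hp : p = 0
  · subst hp
    rw [mul_comm, hb.repr_one_mul]
    simp only [true_and]
    rw [Finset.sum_eq_zero, add_zero]
    intro j _
    split_ifs with hj
    · refine Finset.sum_eq_zero fun k _ => ?_
      simp [hj]
    · rfl
  · rw [if_neg (fun h => hp h.1.symm), zero_add, Finset.sum_eq_single p, if_pos hp,
      Finset.sum_eq_single q]
    · by_cases hpq : p < q
      · simp [hpq]
      · rw [if_neg hpq]
        -- On and below the diagonal the double sum has no term, and the structure constant vanishes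
        -- by triangularity.
        exact hb.repr_mul_basis_eq_zero hi hp (le_max_of_le_right (not_lt.1 hpq))
    · intro k _ hk
      simp [hk]
    · simp
    · intro j _ hj
      split_ifs
      · exact Finset.sum_eq_zero fun k _ => by simp [hj]
      · rfl
    · simp

end IsTriangularBasis

end Shearlet

theorem mainTheorem5 {d : ℕ} [NeZero d] {A : Type*} [CommRing A] [Algebra ℝ A]
    (hd : Module.finrank ℝ A = d) (hA : Shearlet.IsIrreducibleAlgebra A)
    (a : Fin d → A) (ha1 : a 0 = 1) (ha : Shearlet.IsJordanHolderBasis a) :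
    -- `a_1, …, a_d` is a basis `b` of `A`, so that `ψ` is a linear isomorphism
    ∃ b : Module.Basis (Fin d) ℝ A, ⇑b = a ∧
    -- there is exactly one linear map `Ψ` with `ψ⁻¹ (x · ψ v) = Ψ(x) v`, and it satisfies (a)-(d)
    ∃ Ψ : A →ₗ[ℝ] Matrix (Fin d) (Fin d) ℝ,
      (∀ (x : A) (v : Fin d → ℝ), b.equivFun (x * ∑ i, v i • a i) = Ψ x *ᵥ v) ∧
      (∀ Ψ' : A →ₗ[ℝ] Matrix (Fin d) (Fin d) ℝ,
        (∀ (x : A) (v : Fin d → ℝ), b.equivFun (x * ∑ i, v i • a i) = Ψ' x *ᵥ v) → Ψ' = Ψ) ∧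
      -- (a)
      (∃ S : Subgroup (GL (Fin d) ℝ),
        (fun g : GL (Fin d) ℝ => (g : Matrix (Fin d) (Fin d) ℝ)) '' (S : Set (GL (Fin d) ℝ)) =
          {M | ∃ x ∈ Shearlet.nilrad A, M = 1 + (Ψ x)ᵀ} ∧
        Shearlet.IsShearingSubgroup S ∧
        Shearlet.lieAlgebra S = {M | ∃ x ∈ Shearlet.nilrad A, M = (Ψ x)ᵀ} ∧
        -- (b)
        (Ψ (a 0))ᵀ = 1 ∧
        Shearlet.IsCanonicalBasis (Shearlet.lieAlgebra S) (fun i => (Ψ (a i))ᵀ)) ∧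
      -- (c), (d): there are unique structure constants `c i j k`
      ∃ c : Fin d → Fin d → Fin d → ℝ,
        (∀ i j, a i * a j = ∑ k, c i j k • a k) ∧
        (∀ c' : Fin d → Fin d → Fin d → ℝ,
          (∀ i j, a i * a j = ∑ k, c' i j k • a k) → c' = c) ∧
        (∀ i, (Ψ (a i))ᵀ = Matrix.of fun j k => c i j k) ∧
        (∀ i j k, c i j k = c j i k) ∧
        (∀ j k, c 0 j k = if j = k then 1 else 0) ∧
        (∀ i j k, i ≠ 0 → j ≠ 0 → k ≤ max i j → c i j k = 0) ∧
        (∀ i, i ≠ 0 → (Ψ (a i))ᵀ = Matrix.single 0 i 1 +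
          ∑ j ∈ Finset.univ.filter (fun j : Fin d => j ≠ 0),
            ∑ k ∈ Finset.univ.filter (fun k : Fin d => j < k), Matrix.single j k (c i j k)) := by
  obtain ⟨b, rfl⟩ := Shearlet.exists_basis_of_isJordanHolderBasis hd hA ha1 ha
  have hb := ha.isTriangularBasis ha1
  have hmulVec : ∀ (x : A) (v : Fin d → ℝ),
      b.equivFun (x * ∑ i, v i • b i) = Algebra.leftMulMatrix b x *ᵥ v := fun x v => by
    rw [Shearlet.leftMulMatrix_mulVec, b.equivFun_symm_apply]
  refine ⟨b, rfl, (Algebra.leftMulMatrix b).toLinearMap, hmulVec, ?_, ?_, ?_⟩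
  · intro Ψ' hΨ'
    ext1 x
    refine Matrix.ext_of_mulVec_single fun i => ?_
    rw [← hΨ', hmulVec]
    rfl
  · refine ⟨Shearlet.shearGroup b, ?_, hb.isShearingSubgroup, ?_, ?_, ?_⟩
    · rw [Shearlet.coe_image_shearGroup]
      ext M
      constructor
      · rintro ⟨N, ⟨x, hx, rfl⟩, rfl⟩
        exact ⟨x, hx, rfl⟩
      · rintro ⟨x, hx, rfl⟩
        exact ⟨_, ⟨x, hx, rfl⟩, rfl⟩
    · rw [Shearlet.lieAlgebra_shearGroup]
      ext M
      exact Shearlet.mem_shearAlgebra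
    · simp [ha1]
    · rw [Shearlet.lieAlgebra_shearGroup]
      exact hb.isCanonicalBasis
  · refine ⟨fun i j k => b.repr (b i * b j) k, fun i j => (b.sum_repr _).symm, ?_, ?_, ?_,
      hb.repr_one_mul, ?_, ?_⟩
    · intro c' hc'
      ext i j k
      rw [hc', b.repr_sum_self]
    · intro i
      ext j k
      exact Shearlet.transposedRep_apply b (b i) j k
    · intro i j k
      exact congrArg (b.repr · k) (mul_comm (b i) (b j))
    · intro i j k hi hj hk
      exact hb.repr_mul_basis_eq_zero hi hj hk
    · intro i hi
      exact hb.transpose_leftMulMatrix_eq_sum hi
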